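/- **Conventions.** Graphs are finite and simple with vertex set $\{0,\dots,n-1\}$, $n\ge 1$; $\hom(H,G)$ is the number of homomorphisms from $H$ to $G$, and $C_k$ is the cycle of length $k$. A graph is $\kappa$-degenerate if its vertices have an ordering in which each vertex has at most $\kappa$ neighbours among the later ones. Algorithms are Las Vegas algorithms (they halt almost surely and never err) on the randomized word RAM with words of $O(\log n)$ bits, $n$ being the number of vertices of the input graph and the implicit constant depending on the algorithm only. An input graph is given by its number of vertices, its number of edges, and a list of its edges in arbitrary order; memory is otherwise initially zero; time is the number of executed instructions. *Triangle Detection Conjecture:* there is $\gamma>0$ such that every algorithm that decides whether an input graph is triangle-free requires expected time $\Omega(m^{1+\gamma})$ on graphs with $m$ edges, i.e. there is $a>0$ (depending on the algorithm) such that for infinitely many $m$ some input graph with $m$ edges makes the expected running time at least $a\,m^{1+\gamma}$. The problem $\textsc{hom-cnt}_H$ (compute $\hom(H,G)$ for a given graph $G$) is *easy* if there is a function $f$ such that for every $\kappa$ it can be solved in expected time at most $f(\kappa)\cdot n$ on $n$-vertex $\kappa$-degenerate graphs; otherwise it is *hard*. **Lemma.** 1. Assuming the Triangle Detection Conjecture,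 $\textsc{hom-cnt}_{C_k}$ is hard for every $k\ge 6$. 2. (Unconditionally.) For every $k\ge 4$ there is a constant $C$ such that from every graph $F$ one can construct, in deterministic time at most $C(|V(F)|+|E(F)|)$, graphs $G,G'$ such that $|V(G)|,|E(G)|,|V(G')|,|E(G')|\le C(|V(F)|+|E(F)|)$ and such that, given $F$, $\hom(C_k,G)$ and $\hom(C_k,G')$, one can decide whether $F$ is triangle-free in expected time at most $C(|V(F)|+|E(F)|)$. (The construction and the decision are each carried out by one algorithm depending only on $k$.) If $k\ge 6$, then $G$ and $G'$ are moreover $2$-degenerate. -/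

import Mathlib

open scoped ENNReal

/-! ### The randomized word RAM -/

namespace WordRAM

/-- The arithmetic and bitwise operations of the word RAM. -/
inductive BinOp where
  | add | sub | mul | div | mod | and | or | xor | shl | shr

/-- Evaluation of an operation on natural numbers. Subtraction is truncated at `0`, and division
is integer division (with the convention `x / 0 = 0`, `x % 0 = x`). -/
def BinOp.eval : BinOp → ℕ → ℕ → ℕ
  | .add, x, y => x + y
  | .sub, x, y => x - y
  | .mul, x, y => x * y
  | .div, x, y => x / y
  | .mod, x, y => x % y
  | .and, x, y => x &&& y
  | .or, x, y => x ||| y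
  | .xor, x, y => x ^^^ y
  | .shl, x, y => x <<< y
  | .shr, x, y => x >>> y

/-- Instructions. Here `d`, `s`, `a`, `b` are names of registers, and `t` is a position in the
program. Write `R` for the registers and `M` for the memory.
* `const d v`: `R[d] := v`
* `op o d a b`: `R[d] := R[a] o R[b]`
* `load d a`: `R[d] := M[R[a]]`
* `store a s`: `M[R[a]] := R[s]`
* `jmp t`: go to position `t`
* `jlt a b t`: if `R[a] < R[b]` go to position `t`
* `jeq a b t`: if `R[a] = R[b]` go to position `t`
* `rand d s`: `R[d] :=` a uniformly random element of `{0, …, R[s]}`, independent of the past. -/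
inductive Instr where
  | const (d v : ℕ)
  | op (o : BinOp) (d a b : ℕ)
  | load (d a : ℕ)
  | store (a s : ℕ)
  | jmp (t : ℕ)
  | jlt (a b t : ℕ)
  | jeq (a b t : ℕ)
  | rand (d s : ℕ)

/-- A program is a finite list of instructions; it does not depend on the input. -/
abbrev Program := List Instr

/-- A configuration: program counter, registers, memory. -/
structure Config where
  pc : ℕ
  reg : ℕ → ℕ
  mem : ℕ → ℕ

/-- Write `v` into register `d` and go on to the next instruction, if `v` fits into a word of
`w` bits. Otherwise the configuration does not change, so that the machine is stuck forever in
a configuration that is not a halting one: an overflow is a failure. -/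
def Config.write (w : ℕ) (c : Config) (d v : ℕ) : Config :=
  if v < 2 ^ w then { c with pc := c.pc + 1, reg := Function.update c.reg d v } else c

/-- The machine has halted when the program counter points outside the program. -/
def Config.Halted (P : Program) (c : Config) : Prop := P.length ≤ c.pc

/-- One step of the program `P` with words of `w` bits: the law of the next configuration.
A halted machine remains as it is. -/
noncomputable def step (P : Program) (w : ℕ) (c : Config) : PMF Config :=
  match P[c.pc]? with
  | none => PMF.pure c
  | some (.const d v) => PMF.pure (c.write w d v)
  | some (.op o d a b) => PMF.pure (c.write w d (o.eval (c.reg a) (c.reg b)))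
  | some (.load d a) => PMF.pure (c.write w d (c.mem (c.reg a)))
  | some (.store a s) =>
      PMF.pure { c with pc := c.pc + 1, mem := Function.update c.mem (c.reg a) (c.reg s) }
  | some (.jmp t) => PMF.pure { c with pc := t }
  | some (.jlt a b t) => PMF.pure { c with pc := if c.reg a < c.reg b then t else c.pc + 1 }
  | some (.jeq a b t) => PMF.pure { c with pc := if c.reg a = c.reg b then t else c.pc + 1 }
  | some (.rand d s) =>
      (PMF.uniformOfFintype (Fin (c.reg s + 1))).map fun v => c.write w d v

/-- The law of the configuration reached from `c` after `t` steps. -/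
noncomputable def run (P : Program) (w : ℕ) : ℕ → Config → PMF Config
  | 0, c => PMF.pure c
  | t + 1, c => (step P w c).bind (run P w t)

/-- The probability that the program, started in `c`, has not halted after `t` steps. -/
noncomputable def probRunning (P : Program) (w : ℕ) (c : Config) (t : ℕ) : ℝ≥0∞ :=
  (run P w t c).toOuterMeasure {c' | ¬ c'.Halted P}

/-- The expected number `𝔼[T] = ∑ₜ ℙ(T > t)` of steps that the program, started in `c`, makes
before it halts. -/
noncomputable def expectedTime (P : Program) (w : ℕ) (c : Config) : ℝ≥0∞ :=
  ∑' t, probRunning P w c t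

/-- The program, started in `c`, halts with probability one, and each halting configuration that
it can reach satisfies `Q`. -/
def HaltsWith (P : Program) (w : ℕ) (c : Config) (Q : Config → Prop) : Prop :=
  Filter.Tendsto (probRunning P w c) Filter.atTop (nhds 0) ∧
    ∀ t, ∀ c' ∈ (run P w t c).support, c'.Halted P → Q c'

/-- The program, started in `c`, reaches within `T` steps (whatever the random choices) one and the
same halting configuration, and this configuration satisfies `Q`. -/
def HaltsWithin (P : Program) (w : ℕ) (c : Config) (T : ℕ) (Q : Config → Prop) : Prop :=
  ∃ c', run P w T c = PMF.pure c' ∧ c'.Halted P ∧ Q c'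

/-- The initial configuration on an input `x`, a list of words: the input is at the beginning of
the memory, everything else is `0`. -/
def initial (x : List ℕ) : Config where
  pc := 0
  reg := fun _ => 0
  mem := fun i => x.getD i 0

/-- The memory contains the list `x` from address `a` on. -/
def Config.Holds (c : Config) (a : ℕ) (x : List ℕ) : Prop :=
  ∀ i (h : i < x.length), c.mem (a + i) = x[i]

end WordRAM

/-- A (Las Vegas) algorithm on the word RAM with `O(log n)` bits: a program, and the constant
hidden in `O(log n)`. -/
structure Algorithm where
  prog : WordRAM.Program
  const : ℕ

/-- The number of bits in a word, when the size parameter is `n`. -/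
def Algorithm.wordSize (A : Algorithm) (n : ℕ) : ℕ := A.const * (Nat.log 2 n + 1)

/-- On input `x` with size parameter `n` the algorithm halts almost surely, and always with a
result that satisfies `Q`. -/
def Algorithm.HaltsWith (A : Algorithm) (n : ℕ) (x : List ℕ) (Q : WordRAM.Config → Prop) : Prop :=
  WordRAM.HaltsWith A.prog (A.wordSize n) (WordRAM.initial x) Q

/-- On input `x` with size parameter `n` the algorithm halts, deterministically and after at most
`T` steps, with a result that satisfies `Q`. -/
def Algorithm.HaltsWithin (A : Algorithm) (n : ℕ) (x : List ℕ) (T : ℕ)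
    (Q : WordRAM.Config → Prop) : Prop :=
  WordRAM.HaltsWithin A.prog (A.wordSize n) (WordRAM.initial x) T Q

/-- The expected running time on input `x` with size parameter `n`. -/
noncomputable def Algorithm.expectedTime (A : Algorithm) (n : ℕ) (x : List ℕ) : ℝ≥0∞ :=
  WordRAM.expectedTime A.prog (A.wordSize n) (WordRAM.initial x)

/-! ### Graphs as inputs -/

/-- A finite simple graph with vertex set `{0, …, n - 1}`, where `n ≥ 1`, presented by a list of
its edges: each edge occurs exactly once, in an arbitrary place and orientation. -/
structure GraphInput where
  n : ℕ
  pos : 0 < n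
  graph : SimpleGraph (Fin n)
  edges : List (Fin n × Fin n)
  nodup : (edges.map fun e => s(e.1, e.2)).Nodup
  mem_iff : ∀ e : Sym2 (Fin n), e ∈ edges.map (fun e => s(e.1, e.2)) ↔ e ∈ graph.edgeSet

/-- The number of edges. -/
def GraphInput.m (G : GraphInput) : ℕ := G.edges.length

/-- The input words `n, m, u₁, v₁, …, uₘ, vₘ`, where `{uᵢ, vᵢ}` are the edges. -/
def GraphInput.encode (G : GraphInput) : List ℕ :=
  G.n :: G.m :: G.edges.flatMap fun e => [e.1.val, e.2.val]

/-- A graph on `n` vertices is `κ`-degenerate if its vertices can be ordered so that each vertex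
has at most `κ` neighbours among the later ones. -/
def IsDegenerate {n : ℕ} (κ : ℕ) (G : SimpleGraph (Fin n)) : Prop :=
  ∃ v : Fin n ≃ Fin n, ∀ i, {j | i < j ∧ G.Adj (v i) (v j)}.ncard ≤ κ

/-- The number of homomorphisms from `H` to `G`. -/
noncomputable def homCount {V W : Type*} (H : SimpleGraph V) (G : SimpleGraph W) : ℕ :=
  Nat.card (H →g G)

/-! ### The computational problems -/

open Classical in
/-- The answer to the question whether a graph is triangle-free: `1` for yes, `0` for no. -/
noncomputable def triangleFreeAnswer {V : Type*} (F : SimpleGraph V) : ℕ :=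
  if F.CliqueFree 3 then 1 else 0

/-- The algorithm decides whether an input graph is triangle-free. -/
def Algorithm.DecidesTriangleFree (A : Algorithm) : Prop :=
  ∀ F : GraphInput, A.HaltsWith F.n F.encode fun c => c.reg 0 = triangleFreeAnswer F.graph

/-- The Triangle Detection Conjecture: for some `γ > 0`, the worst-case expected running time, over
all graphs with `m` edges, of any algorithm that decides whether a graph is triangle-free is at
least `a * m ^ (1 + γ)` for some constant `a > 0` and infinitely many `m`. -/
def TriangleDetectionConjecture : Prop :=
  ∃ γ : ℝ, 0 < γ ∧ ∀ A : Algorithm, A.DecidesTriangleFree →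
    ∃ a : ℝ, 0 < a ∧ ∃ᶠ m : ℕ in Filter.atTop, ∃ F : GraphInput, F.m = m ∧
      ENNReal.ofReal (a * (m : ℝ) ^ (1 + γ)) ≤ A.expectedTime F.n F.encode

/-- Counting homomorphisms from `H` is easy: it can be done in expected time `f κ * n` for
`n`-vertex `κ`-degenerate graphs, for every `κ`. -/
def HomCountEasy {V : Type*} (H : SimpleGraph V) : Prop :=
  ∃ f : ℕ → ℕ, ∀ κ : ℕ, ∃ A : Algorithm, ∀ G : GraphInput, IsDegenerate κ G.graph →
    A.HaltsWith G.n G.encode (fun c => c.reg 0 = homCount H G.graph) ∧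
      A.expectedTime G.n G.encode ≤ (f κ : ℝ≥0∞) * G.n

/-- Counting homomorphisms from `H` is hard: it is not easy. -/
def HomCountHard {V : Type*} (H : SimpleGraph V) : Prop := ¬ HomCountEasy H

/-! From `F` with `m` edges one builds a base graph whose vertices lie in `k` cyclically arranged
layers, edges joining consecutive layers only. Three layers stand for the vertices of `F`; layers of
darts (oriented edges) subdivide one, two or all three of the adjacencies between them, for `k = 4`,
`k = 5` and `k ≥ 6`; for `k > 6` the remaining layers are copies of layer `0`, joined by an identity
matching. A closed chain through all layers is then the same as a triangle of `F`
(`exists_chain_iff`, `exists_triangle_iff`).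

The two graphs are double covers of the base: two disjoint copies, and the cover in which the sheets
are exchanged between the last layer and layer `0`. A closed walk of length `k` in the base lifts to
two closed walks if it crosses this seam an even number of times, and to none otherwise. So the two
homomorphism counts differ iff some closed `k`-walk crosses it an odd number of times
(`homCount_twoLift_eq_iff`). Such a walk has nonzero winding number, and as its length is the number
of layers, it goes round exactly once and monotonically (`exists_holonomy_ne_zero_iff`). Hence the
counts agree iff `F` is triangle-free (`GraphInput.homCount_eq_iff`). For `k ≥ 6`, removing the
darts, which have degree at most two, leaves only matchings between layers, whence 2-degeneracy
(`ncard_layered_le`).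

For hardness, an algorithm `A` that counts in linear time on 2-degenerate graphs is run on both
covers. The total time has to be `O(m + 1)` without any dependence on the number `n` of vertices,
which may be much larger. Therefore a vertex is represented by its last position in the list of
endpoints, found through a table in memory that is already zero, and the covers have only `O(m + 1)`
vertices. Words of `O(log n)` bits suffice since `m ≤ n ^ 2`. `A` runs as a subroutine with renamed
registers and with its memory on every second cell, three steps for each of its steps
(`Layout.simulate_step`, `Ends.simulate`); the two runs thus have disjoint unbounded memories. -/

namespace WordRAM

/-! ### Runs of a program -/

theorem run_add (P : Program) (w s t : ℕ) (c : Config) :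
    run P w (s + t) c = (run P w s c).bind (run P w t) := by
  induction s generalizing c with
  | zero => simp [run]
  | succ s ih =>
    rw [Nat.add_right_comm, run, run, PMF.bind_bind]
    congr 1
    funext c'
    exact ih c'

theorem run_one (P : Program) (w : ℕ) (c : Config) : run P w 1 c = step P w c := by
  simp only [run]
  exact PMF.bind_pure _

theorem step_of_halted {P : Program} {w : ℕ} {c : Config} (h : c.Halted P) :
    step P w c = PMF.pure c := by
  have : P[c.pc]? = none := List.getElem?_eq_none h
  simp only [step, this]

theorem run_of_step_eq_pure {P : Program} {w : ℕ} {c : Config} (h : step P w c = PMF.pure c)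
    (t : ℕ) : run P w t c = PMF.pure c := by
  induction t with
  | zero => rfl
  | succ t ih => rw [run, h, PMF.pure_bind, ih]

theorem run_of_halted {P : Program} {w : ℕ} {c : Config} (h : c.Halted P) (t : ℕ) :
    run P w t c = PMF.pure c :=
  run_of_step_eq_pure (step_of_halted h) t

/-- Halting configurations are absorbing. -/
theorem mem_support_run_add {P : Program} {w : ℕ} {c c' : Config} {t : ℕ}
    (hc : c' ∈ (run P w t c).support) (h : c'.Halted P) (s : ℕ) :
    c' ∈ (run P w (t + s) c).support := by
  rw [run_add, PMF.mem_support_bind_iff]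
  exact ⟨c', hc, by simp [run_of_halted h]⟩

theorem run_trans {P : Program} {w s t : ℕ} {c c' : Config} (h : run P w s c = PMF.pure c') :
    run P w (s + t) c = run P w t c' := by
  rw [run_add, h, PMF.pure_bind]

theorem probRunning_of_run_add {P : Program} {w n t : ℕ} {c : Config} {α : Type}
    {p : PMF α} {φ : α → Config} (h : run P w n c = p.map φ) :
    probRunning P w c (n + t) = ∑' a, p a * probRunning P w (φ a) t := by
  rw [probRunning, run_add, h, PMF.bind_map, PMF.toOuterMeasure_bind_apply]
  rfl

theorem probRunning_succ (P : Program) (w t : ℕ) (c : Config) :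
    probRunning P w c (t + 1) = ∑' c', step P w c c' * probRunning P w c' t := by
  rw [add_comm]
  exact probRunning_of_run_add (φ := id) (by rw [run_one, PMF.map_id])

theorem probRunning_le_one (P : Program) (w t : ℕ) (c : Config) : probRunning P w c t ≤ 1 := by
  rw [probRunning, PMF.toOuterMeasure_apply, ← (run P w t c).tsum_coe]
  exact ENNReal.tsum_le_tsum fun x => Set.indicator_le_self _ _ x

theorem probRunning_pure {P : Program} {w t : ℕ} {c c' : Config}
    (h : run P w t c = PMF.pure c') (hc : ¬ c'.Halted P) : probRunning P w c t = 1 := by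
  classical
  rw [probRunning, h, PMF.toOuterMeasure_pure_apply]
  exact if_pos hc

theorem probRunning_pure_halted {P : Program} {w t : ℕ} {c c' : Config}
    (h : run P w t c = PMF.pure c') (hc : c'.Halted P) : probRunning P w c t = 0 := by
  classical
  rw [probRunning, h, PMF.toOuterMeasure_pure_apply]
  exact if_neg (by simpa using hc)

/-- First-step analysis; it holds in `ℝ≥0∞` without any finiteness assumption. -/
theorem expectedTime_of_not_halted {P : Program} {w : ℕ} {c : Config} (h : ¬ c.Halted P) :
    expectedTime P w c = 1 + ∑' c', step P w c c' * expectedTime P w c' := by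
  rw [expectedTime, tsum_eq_zero_add' ENNReal.summable, probRunning_pure rfl h]
  simp_rw [probRunning_succ]
  rw [ENNReal.tsum_comm]
  simp_rw [ENNReal.tsum_mul_left]
  rfl

theorem sum_probRunning_le (P : Program) (w n : ℕ) (c : Config) :
    ∑ t ∈ Finset.range n, probRunning P w c t ≤ n := by
  calc _ ≤ ∑ t ∈ Finset.range n, (1 : ℝ≥0∞) :=
        Finset.sum_le_sum fun t _ => probRunning_le_one P w t c
    _ = n := by simp

theorem expectedTime_le_of_sum_le {P : Program} {w : ℕ} {c : Config} {K : ℝ≥0∞}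
    (h : ∀ n, ∑ t ∈ Finset.range n, probRunning P w c t ≤ K) : expectedTime P w c ≤ K := by
  rw [expectedTime, ENNReal.tsum_eq_iSup_nat]
  exact iSup_le h

theorem sum_le_expectedTime (P : Program) (w n : ℕ) (c : Config) :
    ∑ t ∈ Finset.range n, probRunning P w c t ≤ expectedTime P w c :=
  ENNReal.sum_le_tsum _

/-- From `c` the program halts after an expected number of at most `K` steps, and only in
configurations that satisfy `Q`. -/
structure Ends (P : Program) (w : ℕ) (Q : Config → Prop) (K : ℝ≥0∞) (c : Config) : Prop where
  time : expectedTime P w c ≤ K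
  post : ∀ t, ∀ c' ∈ (run P w t c).support, c'.Halted P → Q c'

/-! ### Expected times of composed and simulated computations -/

namespace Ends

variable {P : Program} {w : ℕ} {Q : Config → Prop} {K : ℝ≥0∞} {c c' : Config}

theorem haltsWith (h : Ends P w Q K c) (hK : K ≠ ∞) : HaltsWith P w c Q :=
  ⟨ENNReal.tendsto_atTop_zero_of_tsum_ne_top (ne_top_of_le_ne_top hK h.time), h.post⟩

theorem of_halted (hc : c.Halted P) (hQ : Q c) : Ends P w Q 0 c where
  time := expectedTime_le_of_sum_le fun n => by
    rw [Finset.sum_eq_zero fun t _ => probRunning_pure_halted (run_of_halted hc t) hc]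
  post t c' hc' _ := by
    rw [run_of_halted hc, PMF.mem_support_pure_iff] at hc'
    rwa [hc']

theorem of_run {n : ℕ} (hr : run P w n c = PMF.pure c') (h : Ends P w Q K c') :
    Ends P w Q (n + K) c where
  time := by
    rw [expectedTime, ← Summable.sum_add_tsum_nat_add' (k := n) ENNReal.summable]
    refine add_le_add (sum_probRunning_le P w n c) ?_
    refine le_trans (le_of_eq ?_) h.time
    refine tsum_congr fun t => ?_
    rw [probRunning, add_comm, run_trans hr, probRunning]
  post t d hd hh := by
    have := mem_support_run_add hd hh n
    rw [add_comm, run_trans hr] at this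
    exact h.post t d this hh

theorem mono {K' : ℝ≥0∞} (h : Ends P w Q K c) (hK : K ≤ K') : Ends P w Q K' c :=
  ⟨h.time.trans hK, h.post⟩

/-- If `P` simulates each step of `A` by exactly three steps, and goes on for an expected number
of at most `K` steps when `A` has halted, then its expected running time is at most
`3 * T + K`, where `T` is the one of `A`. -/
theorem simulate {A : Program} {v : ℕ} {S : Config → Config → Prop}
    (hstep : ∀ a c, S a c → ¬ a.Halted A → ∃ φ : Config → Config,
      run P w 3 c = (step A v a).map φ ∧ ∀ a' ∈ (step A v a).support, S a' (φ a'))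
    (hrun : ∀ a c, S a c → ¬ c.Halted P)
    (hexit : ∀ a c, S a c → a.Halted A → Ends P w Q K c)
    {a : Config} (hac : S a c) : Ends P w Q (3 * expectedTime A v a + K) c where
  time := by
    refine expectedTime_le_of_sum_le fun T => ?_
    -- Bounding the partial sums permits induction on the cut-off. One simulated step consumes three
    -- terms, but lowering the cut-off by one is enough.
    induction T generalizing a c with
    | zero => simp
    | succ T ih =>
      by_cases ha : a.Halted A
      · exact (sum_le_expectedTime P w _ c).trans
          ((hexit a c hac ha).time.trans le_add_self)
      obtain ⟨φ, hφ, hS⟩ := hstep a c hac ha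
      calc ∑ t ∈ Finset.range (T + 1), probRunning P w c t
          ≤ ∑ t ∈ Finset.range (3 + T), probRunning P w c t :=
            Finset.sum_le_sum_of_subset (Finset.range_mono (by omega))
        _ = ∑ t ∈ Finset.range 3, probRunning P w c t +
              ∑ t ∈ Finset.range T, probRunning P w c (3 + t) := Finset.sum_range_add _ _ _
        _ ≤ 3 + ∑' a', step A v a a' * ∑ t ∈ Finset.range T, probRunning P w (φ a') t := by
            refine add_le_add (by exact_mod_cast sum_probRunning_le P w 3 c) (le_of_eq ?_)
            simp_rw [probRunning_of_run_add hφ, Finset.mul_sum]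
            exact (Summable.tsum_finsetSum fun _ _ => ENNReal.summable).symm
        _ ≤ 3 + ∑' a', step A v a a' * (3 * expectedTime A v a' + K) := by
            refine add_le_add le_rfl (ENNReal.tsum_le_tsum fun a' => ?_)
            by_cases h0 : step A v a a' = 0
            · simp [h0]
            · exact mul_le_mul_right (ih (hS a' ((PMF.mem_support_iff _ _).2 h0))) _
        _ = 3 * expectedTime A v a + K := by
            rw [expectedTime_of_not_halted ha]
            simp_rw [mul_add, mul_left_comm _ (3 : ℝ≥0∞)]
            rw [ENNReal.tsum_add, ENNReal.tsum_mul_left, ENNReal.tsum_mul_right, PMF.tsum_coe,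
              one_mul, mul_one, add_assoc]
  post t := by
    induction t using Nat.strong_induction_on generalizing a c with
    | _ t ih =>
      intro d hd hh
      by_cases ha : a.Halted A
      · exact (hexit a c hac ha).post t d hd hh
      obtain ⟨φ, hφ, hS⟩ := hstep a c hac ha
      rcases le_or_gt 3 t with ht | ht
      · obtain ⟨s, rfl⟩ := Nat.exists_eq_add_of_le ht
        rw [run_add, hφ, PMF.bind_map, PMF.mem_support_bind_iff] at hd
        obtain ⟨a', ha', hd⟩ := hd
        exact ih s (by omega) (hS a' ha') d hd hh
      -- A halt within the three steps would persist to their end, where the configuration again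
      -- simulates one of `A` and so has not halted.
      · have h3 := mem_support_run_add hd hh (3 - t)
        rw [Nat.add_sub_cancel' ht.le, hφ, PMF.mem_support_map_iff] at h3
        obtain ⟨a', ha', rfl⟩ := h3
        exact absurd hh (hrun _ _ (hS a' ha'))

end Ends

end WordRAM

namespace WordRAM

/-! ### Relocation of a program -/

/-- The program `P` contains the code `l` from position `q` on. -/
def CodeAt (P : Program) (q : ℕ) (l : List Instr) : Prop :=
  ∀ i, i < l.length → P[q + i]? = l[i]?

theorem CodeAt.left {P : Program} {q : ℕ} {l l' : List Instr} (h : CodeAt P q (l ++ l')) :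
    CodeAt P q l := fun i hi => by
  rw [h i (by simp; omega), List.getElem?_append_left hi]

theorem CodeAt.right {P : Program} {q : ℕ} {l l' : List Instr} (h : CodeAt P q (l ++ l')) :
    CodeAt P (q + l.length) l' := fun i hi => by
  rw [add_assoc, h (l.length + i) (by simp; omega), List.getElem?_append_right (by omega)]
  simp

/-- Where the simulation of a program keeps registers and memory: register `r` is renamed to
`reg r`, and address `x` is moved to `b + 2 * x`, where register `base` contains `b`
and register `two` contains `2`. The code starts at position `off`, register `tmp` is scratch. -/
structure Layout where
  reg : ℕ → ℕ
  inj : Function.Injective reg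
  tmp : ℕ
  two : ℕ
  base : ℕ
  tmp_ne_two : tmp ≠ two
  tmp_ne_base : tmp ≠ base
  tmp_ne : ∀ r, reg r ≠ tmp
  two_ne : ∀ r, reg r ≠ two
  base_ne : ∀ r, reg r ≠ base

namespace Layout

variable (Λ : Layout)

/-- The three instructions, at position `q`, that simulate an instruction. -/
def instr (tgt : ℕ → ℕ) (q : ℕ) : Instr → List Instr
  | .const d v => [.jmp (q + 1), .jmp (q + 2), .const (Λ.reg d) v]
  | .op o d a b => [.jmp (q + 1), .jmp (q + 2), .op o (Λ.reg d) (Λ.reg a) (Λ.reg b)]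
  | .load d a =>
    [.op .mul Λ.tmp (Λ.reg a) Λ.two, .op .add Λ.tmp Λ.tmp Λ.base, .load (Λ.reg d) Λ.tmp]
  | .store a s =>
    [.op .mul Λ.tmp (Λ.reg a) Λ.two, .op .add Λ.tmp Λ.tmp Λ.base, .store Λ.tmp (Λ.reg s)]
  | .jmp t => [.jmp (q + 1), .jmp (q + 2), .jmp (tgt t)]
  | .jlt a b t => [.jmp (q + 1), .jmp (q + 2), .jlt (Λ.reg a) (Λ.reg b) (tgt t)]
  | .jeq a b t => [.jmp (q + 1), .jmp (q + 2), .jeq (Λ.reg a) (Λ.reg b) (tgt t)]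
  | .rand d s => [.jmp (q + 1), .jmp (q + 2), .rand (Λ.reg d) (Λ.reg s)]

/-- This uniform length is why `instr` pads with jumps: jump targets become affine in the original
position, and time is multiplied by exactly three. -/
theorem length_instr (tgt : ℕ → ℕ) (q : ℕ) (I : Instr) : (Λ.instr tgt q I).length = 3 := by
  cases I <;> rfl

/-- The simulation of a list of instructions, placed at position `q`. -/
def block (tgt : ℕ → ℕ) : ℕ → List Instr → List Instr
  | _, [] => []
  | q, I :: l => Λ.instr tgt q I ++ block tgt (q + 3) l

theorem length_block (tgt : ℕ → ℕ) (q : ℕ) (l : List Instr) :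
    (Λ.block tgt q l).length = 3 * l.length := by
  induction l generalizing q with
  | nil => rfl
  | cons I l ih => simp [block, length_instr, ih]; omega

theorem codeAt_block {P : Program} {tgt : ℕ → ℕ} {q : ℕ} {l : List Instr}
    (h : CodeAt P q (Λ.block tgt q l)) {i : ℕ} {I : Instr} (hI : l[i]? = some I) :
    CodeAt P (q + 3 * i) (Λ.instr tgt (q + 3 * i) I) := by
  induction l generalizing q i with
  | nil => simp at hI
  | cons J l ih =>
    cases i with
    | zero =>
      obtain rfl : J = I := by simpa using hI
      exact h.left
    | succ i =>
      have h2 := h.right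
      rw [length_instr] at h2
      have := ih h2 (i := i) (by simpa using hI)
      rwa [show q + 3 + 3 * i = q + 3 * (i + 1) by ring] at this

/-- The position that simulates position `t` of a program of length `len`. -/
def target (off len t : ℕ) : ℕ := off + 3 * min t len

/-- The relocated program. -/
def relocate (off : ℕ) (A : Program) : Program := Λ.block (target off A.length) off A

theorem length_relocate (off : ℕ) (A : Program) : (Λ.relocate off A).length = 3 * A.length :=
  Λ.length_block _ _ _

/-- The configuration that simulates `a`; the rest of registers and memory is given by `g`, `h`. -/
noncomputable def embed (off len b : ℕ) (g h : ℕ → ℕ) (a : Config) : Config where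
  pc := target off len a.pc
  reg := Function.extend Λ.reg a.reg g
  mem := Function.extend (fun x => b + 2 * x) a.mem h

end Layout

/-- With `e` the renaming of registers or addresses, writes of the simulated machine act on `f`
alone, while writes outside the range of `e` act on `g` alone. -/
theorem update_extend {e : ℕ → ℕ} (he : Function.Injective e) (f g : ℕ → ℕ) (d v : ℕ) :
    Function.update (Function.extend e f g) (e d) v
      = Function.extend e (Function.update f d v) g := by
  funext x
  by_cases hx : ∃ y, e y = x
  · obtain ⟨y, rfl⟩ := hx
    rw [he.extend_apply]
    by_cases hy : y = d
    · subst hy; simp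
    · rw [Function.update_of_ne (he.ne hy), Function.update_of_ne hy, he.extend_apply]
  · rw [Function.extend_apply' _ _ _ hx, Function.update_of_ne (fun h => hx ⟨d, h.symm⟩),
      Function.extend_apply' _ _ _ hx]

theorem update_extend_of_ne {e : ℕ → ℕ} (he : Function.Injective e) (f g : ℕ → ℕ) {d : ℕ} (v : ℕ)
    (hd : ∀ r, e r ≠ d) :
    Function.update (Function.extend e f g) d v
      = Function.extend e f (Function.update g d v) := by
  funext x
  by_cases hx : ∃ y, e y = x
  · obtain ⟨y, rfl⟩ := hx
    rw [he.extend_apply, Function.update_of_ne (hd y), he.extend_apply]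
  · rw [Function.extend_apply' _ _ _ hx]
    by_cases h : x = d
    · subst h; simp
    · rw [Function.update_of_ne h, Function.update_of_ne h, Function.extend_apply' _ _ _ hx]

theorem run_three {P : Program} {w : ℕ} {c c₁ c₂ : Config} (h₁ : step P w c = PMF.pure c₁)
    (h₂ : step P w c₁ = PMF.pure c₂) : run P w 3 c = step P w c₂ := by
  rw [← run_one] at h₁ h₂
  rw [show 3 = 1 + (1 + 1) from rfl, run_trans h₁, run_trans h₂, run_one]

theorem run_three_of_jmp {P : Program} {w : ℕ} {c : Config} {I : Instr}
    (h : CodeAt P c.pc [.jmp (c.pc + 1), .jmp (c.pc + 2), I]) :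
    run P w 3 c = step P w { c with pc := c.pc + 2 } := by
  have h0 := h 0 (by simp)
  have h1 := h 1 (by simp)
  simp only [add_zero, List.getElem?_cons_zero, List.getElem?_cons_succ] at h0 h1
  exact run_three (c₁ := { c with pc := c.pc + 1 }) (by simp only [step, h0])
    (by simp only [step, h1])

/-- The law of the next configuration after `rand`. -/
noncomputable def randLaw (x : ℕ) (f : ℕ → Config) : PMF Config :=
  (PMF.uniformOfFintype (Fin (x + 1))).map fun v : Fin (x + 1) => f v.val

theorem step_rand {P : Program} {w : ℕ} {c : Config} {d s : ℕ} (h : P[c.pc]? = some (.rand d s)) :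
    step P w c = randLaw (c.reg s) (c.write w d) := by
  simp only [step, h]
  exact PMF.map_comp Fin.val _ (c.write w d)

theorem randLaw_map {x : ℕ} {f g : ℕ → Config} {φ : Config → Config}
    (h : ∀ v ≤ x, g v = φ (f v)) : randLaw x g = (randLaw x f).map φ := by
  rw [randLaw, randLaw, PMF.map_comp]
  congr 1
  funext v
  exact h v (Nat.le_of_lt_succ v.isLt)

theorem mem_support_randLaw {x : ℕ} {f : ℕ → Config} {c : Config}
    (h : c ∈ (randLaw x f).support) : ∃ v ≤ x, c = f v := by
  rw [randLaw, PMF.mem_support_map_iff] at h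
  obtain ⟨v, -, rfl⟩ := h
  exact ⟨v, Nat.le_of_lt_succ v.isLt, rfl⟩

theorem Config.write_of_lt {w : ℕ} {c : Config} {d v : ℕ} (h : v < 2 ^ w) :
    c.write w d v = { c with pc := c.pc + 1, reg := Function.update c.reg d v } :=
  if_pos h

theorem Config.write_of_le {w : ℕ} {c : Config} {d v : ℕ} (h : 2 ^ w ≤ v) : c.write w d v = c :=
  if_neg (by omega)

/-- A configuration from which a program halts almost surely, with result `Q`, and the registers
of which contain words of `v` bits. -/
structure Sound (A : Program) (v : ℕ) (Q : Config → Prop) (a : Config) : Prop where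
  halts : HaltsWith A v a Q
  reg_lt : ∀ r, a.reg r < 2 ^ v

namespace Sound

variable {A : Program} {v : ℕ} {Q : Config → Prop} {a : Config}

/-- A configuration fixed by its own step is never left, against almost sure halting. Since an
overflow leaves the configuration unchanged, this excludes overflows in the simulated program. -/
theorem step_ne (h : Sound A v Q a) (ha : ¬ a.Halted A) : step A v a ≠ PMF.pure a := fun hs => by
  have h1 : probRunning A v a = fun _ => 1 :=
    funext fun t => probRunning_pure (run_of_step_eq_pure hs t) ha
  have h2 := h.halts.1
  rw [h1] at h2
  exact one_ne_zero (tendsto_nhds_unique tendsto_const_nhds h2)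

/-- The probability of still running from `a'` is at most the one from `a`, a step later, divided by
the positive transition probability. -/
theorem next_halts (h : Sound A v Q a) {a' : Config} (ha' : a' ∈ (step A v a).support) :
    HaltsWith A v a' Q := by
  have h0 : step A v a a' ≠ 0 := (PMF.mem_support_iff _ _).1 ha'
  refine ⟨?_, fun t c hc => h.halts.2 (t + 1) c ?_⟩
  · have h1 : Filter.Tendsto (fun t => (step A v a a')⁻¹ * probRunning A v a (t + 1))
        Filter.atTop (nhds 0) := by
      have := ENNReal.Tendsto.const_mul (a := (step A v a a')⁻¹)
        (h.halts.1.comp (Filter.tendsto_add_atTop_nat 1)) (Or.inr (ENNReal.inv_ne_top.2 h0))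
      simpa using this
    refine tendsto_of_tendsto_of_tendsto_of_le_of_le tendsto_const_nhds h1
      (fun _ => zero_le) fun t => ?_
    have h2 : step A v a a' * probRunning A v a' t ≤ probRunning A v a (t + 1) := by
      rw [probRunning_succ]
      exact ENNReal.le_tsum (f := fun c' => step A v a c' * probRunning A v c' t) a'
    calc probRunning A v a' t
        = (step A v a a')⁻¹ * (step A v a a' * probRunning A v a' t) := by
          rw [← mul_assoc, ENNReal.inv_mul_cancel h0 (PMF.apply_ne_top _ _), one_mul]
      _ ≤ _ := mul_le_mul_right h2 _
  · rw [run, PMF.mem_support_bind_iff]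
    exact ⟨a', ha', hc⟩

/-- Registers change only through `write`, which checks the width. Memory needs no such bound, as
loads pass through `write` too. -/
theorem next (h : Sound A v Q a) {a' : Config} (ha' : a' ∈ (step A v a).support) :
    Sound A v Q a' := by
  refine ⟨h.next_halts ha', ?_⟩
  have hw : ∀ d x, ∀ r, (a.write v d x).reg r < 2 ^ v := fun d x r => by
    rcases lt_or_ge x (2 ^ v) with hx | hx
    · rw [Config.write_of_lt hx]
      by_cases hr : r = d
      · subst hr; simpa using hx
      · simpa [hr] using h.reg_lt r
    · rw [Config.write_of_le hx]
      exact h.reg_lt r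
  match hI : A[a.pc]? with
  | none | some (.jmp t) | some (.jlt b c t) | some (.jeq b c t) | some (.store b c) =>
    simp only [step, hI, PMF.mem_support_pure_iff] at ha'
    subst ha'
    exact h.reg_lt
  | some (.const d x) | some (.op o d b c) | some (.load d b) =>
    simp only [step, hI, PMF.mem_support_pure_iff] at ha'
    subst ha'
    exact hw _ _
  | some (.rand d s) =>
    rw [step_rand hI] at ha'
    obtain ⟨x, -, rfl⟩ := mem_support_randLaw ha'
    exact hw _ _

end Sound

/-! ### Correctness of the relocated program -/

namespace Layout

variable (Λ : Layout)

theorem target_succ {off len t : ℕ} (h : t < len) :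
    target off len t + 3 = target off len (t + 1) := by
  unfold target; omega

/-- `hw` leaves room for the address `b + 2 * x` of any register content `x < 2 ^ v`. All words that
`A` writes fit, by `step_ne`. Outside the simulated part only the scratch register changes, whence
`g'`. -/
theorem simulate_step {P A : Program} {w v off b : ℕ} {g h : ℕ → ℕ} {Q : Config → Prop}
    {a : Config} (hcode : CodeAt P off (Λ.relocate off A)) (hw : 2 ^ v * 2 + b ≤ 2 ^ w)
    (h2 : g Λ.two = 2) (hb : g Λ.base = b) (ha : Sound A v Q a) (hh : ¬ a.Halted A) :
    ∃ g' : ℕ → ℕ, (∀ r, r ≠ Λ.tmp → g' r = g r) ∧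
      run P w 3 (Λ.embed off A.length b g h a)
        = (step A v a).map (Λ.embed off A.length b g' h) := by
  have hpc : a.pc < A.length := not_le.1 hh
  obtain ⟨I, hI⟩ : ∃ I, A[a.pc]? = some I := ⟨_, List.getElem?_eq_getElem hpc⟩
  have hq : (Λ.embed off A.length b g h a).pc = off + 3 * a.pc := by
    simp only [embed, target]; omega
  have hq' : (Λ.embed off A.length b g h a).pc + 3 = target off A.length (a.pc + 1) :=
    target_succ hpc
  have hc := Λ.codeAt_block hcode hI
  rw [← hq] at hc
  have hne := ha.step_ne hh
  have hvw : ∀ {x : ℕ}, x < 2 ^ v → x < 2 ^ w := fun hx => by omega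
  have hreg : ∀ r, (Λ.embed off A.length b g h a).reg (Λ.reg r) = a.reg r := fun r =>
    Λ.inj.extend_apply _ _ _
  have hi0 : Function.Injective fun x : ℕ => b + 2 * x := fun x y hxy => by
    simp only at hxy; omega
  -- an instruction that writes a register
  have hwrite : ∀ d x, x < 2 ^ v →
      ({ Λ.embed off A.length b g h a with
          pc := (Λ.embed off A.length b g h a).pc + 2 } : Config).write w (Λ.reg d) x
        = Λ.embed off A.length b g h (a.write v d x) := fun d x hx => by
    rw [Config.write_of_lt (hvw hx), Config.write_of_lt hx]
    simp only [embed] at hq' ⊢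
    rw [← hq', update_extend Λ.inj]
  -- the address computation
  set y := target off A.length a.pc with hy
  have haddr : ∀ r J, CodeAt P y [.op .mul Λ.tmp (Λ.reg r) Λ.two, .op .add Λ.tmp Λ.tmp Λ.base, J] →
      ∃ g' : ℕ → ℕ, (∀ r, r ≠ Λ.tmp → g' r = g r) ∧ g' Λ.tmp = b + 2 * a.reg r ∧
        run P w 3 (Λ.embed off A.length b g h a)
          = step P w { Λ.embed off A.length b g' h a with pc := y + 2 } := by
    intro r J hJ
    have e0 := hJ 0 (by simp)
    have e1 := hJ 1 (by simp)
    simp only [add_zero, List.getElem?_cons_zero, List.getElem?_cons_succ] at e0 e1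
    have hr := ha.reg_lt r
    have hnt : ¬ ∃ r, Λ.reg r = Λ.tmp := fun ⟨r, h⟩ => Λ.tmp_ne r h
    have hn2 : ¬ ∃ r, Λ.reg r = Λ.two := fun ⟨r, h⟩ => Λ.two_ne r h
    have hnb : ¬ ∃ r, Λ.reg r = Λ.base := fun ⟨r, h⟩ => Λ.base_ne r h
    refine ⟨Function.update (Function.update g Λ.tmp (a.reg r * 2)) Λ.tmp (a.reg r * 2 + b),
      fun s hs => by simp [hs], by simp; ring, ?_⟩
    refine run_three
      (c₁ := { Λ.embed off A.length b (Function.update g Λ.tmp (a.reg r * 2)) h a with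
        pc := y + 1 }) ?_ ?_
    · have : (Λ.embed off A.length b g h a).pc = y := rfl
      simp only [step, this, e0, hreg, BinOp.eval]
      have : (Λ.embed off A.length b g h a).reg Λ.two = 2 := by
        simp only [embed]
        rw [Function.extend_apply' _ _ _ hn2, h2]
      rw [this, Config.write_of_lt (by omega)]
      simp only [embed]
      rw [update_extend_of_ne Λ.inj _ _ _ Λ.tmp_ne]
    · simp only [step, e1, BinOp.eval, embed]
      rw [Function.extend_apply' _ _ _ hnt, Function.extend_apply' _ _ _ hnb,
        Function.update_self, Function.update_of_ne Λ.tmp_ne_base.symm, hb,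
        Config.write_of_lt (by omega)]
      simp only
      rw [update_extend_of_ne Λ.inj _ _ _ Λ.tmp_ne]
  have hlast : ∀ {J₀ J₁ J : Instr}, CodeAt P y [J₀, J₁, J] → P[y + 2]? = some J := fun hJ => by
    simpa using hJ 2 (by simp)
  have hyy : (Λ.embed off A.length b g h a).pc = y := rfl
  cases I with
  | const d x =>
    have hx : x < 2 ^ v := by
      by_contra hx
      exact hne (by simp only [step, hI]; rw [Config.write_of_le (not_lt.1 hx)])
    refine ⟨g, fun _ _ => rfl, ?_⟩
    rw [run_three_of_jmp hc]
    simp only [step, hyy, hlast hc, hI, PMF.pure_map]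
    rw [← hwrite d x hx, hyy]
  | op o d s t =>
    have hx : o.eval (a.reg s) (a.reg t) < 2 ^ v := by
      by_contra hx
      exact hne (by simp only [step, hI]; rw [Config.write_of_le (not_lt.1 hx)])
    refine ⟨g, fun _ _ => rfl, ?_⟩
    rw [run_three_of_jmp hc]
    simp only [step, hyy, hlast hc, hI, PMF.pure_map, hreg]
    rw [← hwrite d _ hx, hyy]
  | load d s =>
    have hx : a.mem (a.reg s) < 2 ^ v := by
      by_contra hx
      exact hne (by simp only [step, hI]; rw [Config.write_of_le (not_lt.1 hx)])
    obtain ⟨g', hg', ht, hrun⟩ := haddr s _ hc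
    refine ⟨g', hg', ?_⟩
    have hnt : ¬ ∃ r, Λ.reg r = Λ.tmp := fun ⟨r, h⟩ => Λ.tmp_ne r h
    rw [hrun]
    simp only [step, hlast hc, hI, PMF.pure_map]
    have e1 : (Λ.embed off A.length b g' h a).mem ((Λ.embed off A.length b g' h a).reg Λ.tmp)
        = a.mem (a.reg s) := by
      simp only [embed]
      rw [Function.extend_apply' _ _ _ hnt, ht]
      exact hi0.extend_apply _ _ _
    rw [e1, Config.write_of_lt (hvw hx), Config.write_of_lt hx]
    simp only [embed] at hq' ⊢
    rw [← hq', update_extend Λ.inj]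
  | store s t =>
    obtain ⟨g', hg', ht, hrun⟩ := haddr s _ hc
    refine ⟨g', hg', ?_⟩
    have hnt : ¬ ∃ r, Λ.reg r = Λ.tmp := fun ⟨r, h⟩ => Λ.tmp_ne r h
    rw [hrun]
    simp only [step, hlast hc, hI, PMF.pure_map]
    simp only [embed] at hq' ⊢
    rw [← hq', Function.extend_apply' _ _ _ hnt, ht, Λ.inj.extend_apply]
    congr 2
    exact update_extend hi0 _ _ _ _
  | jmp t =>
    refine ⟨g, fun _ _ => rfl, ?_⟩
    rw [run_three_of_jmp hc]
    simp only [step, hyy, hlast hc, hI, PMF.pure_map]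
    rfl
  | jlt s t u =>
    refine ⟨g, fun _ _ => rfl, ?_⟩
    rw [run_three_of_jmp hc]
    simp only [step, hyy, hlast hc, hI, PMF.pure_map, hreg]
    simp only [embed] at hq' ⊢
    split_ifs
    · rfl
    · rw [← hq']
  | jeq s t u =>
    refine ⟨g, fun _ _ => rfl, ?_⟩
    rw [run_three_of_jmp hc]
    simp only [step, hyy, hlast hc, hI, PMF.pure_map, hreg]
    simp only [embed] at hq' ⊢
    split_ifs
    · rfl
    · rw [← hq']
  | rand d s =>
    refine ⟨g, fun _ _ => rfl, ?_⟩
    rw [run_three_of_jmp hc, step_rand hI, step_rand (hlast hc)]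
    simp only [hreg]
    -- A random word is at most the content of a register, so no outcome overflows in either
    -- machine.
    exact randLaw_map fun x hx => hwrite d x (hx.trans_lt (ha.reg_lt s))

/-- A program that contains a relocated copy of `A`, and goes on for an expected number of at most
`K` steps afterwards. -/
theorem ends_embed {P A : Program} {w v off b : ℕ} {g h : ℕ → ℕ} {Q Q' : Config → Prop}
    {K : ℝ≥0∞} {a : Config} (hcode : CodeAt P off (Λ.relocate off A))
    (hlen : off + 3 * A.length < P.length) (hw : 2 ^ v * 2 + b ≤ 2 ^ w)
    (h2 : g Λ.two = 2) (hb : g Λ.base = b) (ha : Sound A v Q a)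
    (hexit : ∀ a' g', Q a' → (∀ r, r ≠ Λ.tmp → g' r = g r) →
      Ends P w Q' K ⟨off + 3 * A.length, Function.extend Λ.reg a'.reg g',
        Function.extend (fun x => b + 2 * x) a'.mem h⟩) :
    Ends P w Q' (3 * expectedTime A v a + K) (Λ.embed off A.length b g h a) := by
  refine Ends.simulate
    (S := fun a c => Sound A v Q a ∧ ∃ g' : ℕ → ℕ, (∀ r, r ≠ Λ.tmp → g' r = g r) ∧
      c = Λ.embed off A.length b g' h a) ?_ ?_ ?_ ⟨ha, g, fun _ _ => rfl, rfl⟩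
  · rintro a c ⟨ha, g', hg', rfl⟩ hh
    obtain ⟨g'', hg'', hrun⟩ := Λ.simulate_step (h := h) hcode hw
      ((hg' _ Λ.tmp_ne_two.symm).trans h2) ((hg' _ Λ.tmp_ne_base.symm).trans hb) ha hh
    exact ⟨_, hrun, fun a' ha' => ⟨ha.next ha', g'', fun r hr => (hg'' r hr).trans (hg' r hr), rfl⟩⟩
  · rintro a c ⟨ha, g', hg', rfl⟩ hh
    simp only [Config.Halted, embed, target] at hh
    omega
  · rintro a c ⟨ha, g', hg', rfl⟩ hh
    have hQ : Q a := ha.halts.2 0 a (by simp [run]) hh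
    have := hexit a g' hQ hg'
    have e : target off A.length a.pc = off + 3 * A.length := by
      simp only [Config.Halted] at hh
      simp only [target]
      omega
    rwa [embed, e]

end Layout

end WordRAM

namespace WordRAM

/-! ### Verification of deterministic code -/

/-- The weakest precondition of `Q` for straight-line code with words of `w` bits. -/
def Wp (w : ℕ) : List Instr → (ℕ → ℕ) → (ℕ → ℕ) → ((ℕ → ℕ) → (ℕ → ℕ) → Prop) → Prop
  | [], r, m, Q => Q r m
  | .const d v :: l, r, m, Q => v < 2 ^ w ∧ Wp w l (Function.update r d v) m Q
  | .op o d a b :: l, r, m, Q =>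
    o.eval (r a) (r b) < 2 ^ w ∧ Wp w l (Function.update r d (o.eval (r a) (r b))) m Q
  | .load d a :: l, r, m, Q => m (r a) < 2 ^ w ∧ Wp w l (Function.update r d (m (r a))) m Q
  | .store a s :: l, r, m, Q => Wp w l r (Function.update m (r a) (r s)) Q
  | _ :: _, _, _, _ => False

/-- From position `q`, registers `r` and memory `m`, the program reaches position `q'` within `T`
steps, with registers and memory that satisfy `Q`. -/
def Reaches (P : Program) (w q q' T : ℕ) (r m : ℕ → ℕ) (Q : (ℕ → ℕ) → (ℕ → ℕ) → Prop) : Prop :=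
  ∃ t ≤ T, ∃ r' m', run P w t ⟨q, r, m⟩ = PMF.pure ⟨q', r', m'⟩ ∧ Q r' m'

theorem Reaches.trans {P : Program} {w q q' q'' T T' : ℕ} {r m : ℕ → ℕ}
    {Q Q' : (ℕ → ℕ) → (ℕ → ℕ) → Prop} (h : Reaches P w q q' T r m Q)
    (h' : ∀ r' m', Q r' m' → Reaches P w q' q'' T' r' m' Q') :
    Reaches P w q q'' (T + T') r m Q' := by
  obtain ⟨t, ht, r', m', hr, hQ⟩ := h
  obtain ⟨t', ht', r'', m'', hr', hQ'⟩ := h' r' m' hQ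
  exact ⟨t + t', by omega, r'', m'', by rw [run_trans hr, hr'], hQ'⟩

theorem Reaches.mono {P : Program} {w q q' T T' : ℕ} {r m : ℕ → ℕ}
    {Q Q' : (ℕ → ℕ) → (ℕ → ℕ) → Prop} (h : Reaches P w q q' T r m Q) (hT : T ≤ T')
    (hQ : ∀ r m, Q r m → Q' r m) : Reaches P w q q' T' r m Q' := by
  obtain ⟨t, ht, r', m', hr, hq⟩ := h
  exact ⟨t, ht.trans hT, r', m', hr, hQ _ _ hq⟩

theorem Reaches.of_step {P : Program} {w q q' q'' T : ℕ} {r m r' m' : ℕ → ℕ}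
    {Q : (ℕ → ℕ) → (ℕ → ℕ) → Prop}
    (hs : step P w ⟨q, r, m⟩ = PMF.pure ⟨q', r', m'⟩) (h : Reaches P w q' q'' T r' m' Q) :
    Reaches P w q q'' (T + 1) r m Q := by
  obtain ⟨t, ht, r'', m'', hr, hq⟩ := h
  refine ⟨1 + t, by omega, r'', m'', ?_, hq⟩
  rw [← run_one] at hs
  rw [run_trans hs, hr]

theorem Reaches.of_wp {P : Program} {w : ℕ} {l : List Instr} {q : ℕ} {r m : ℕ → ℕ}
    {Q : (ℕ → ℕ) → (ℕ → ℕ) → Prop} (hc : CodeAt P q l) (h : Wp w l r m Q) :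
    Reaches P w q (q + l.length) l.length r m Q := by
  induction l generalizing q r m with
  | nil => exact ⟨0, le_rfl, r, m, rfl, h⟩
  | cons I l ih =>
    have h0 : P[q]? = some I := by simpa using hc 0 (by simp)
    have ht : CodeAt P (q + 1) l := CodeAt.right (l := [I]) hc
    rw [List.length_cons, add_comm l.length 1, ← add_assoc, add_comm 1 l.length]
    cases I with
    | const d v =>
      exact Reaches.of_step (by simp only [step, h0]; rw [Config.write_of_lt h.1]) (ih ht h.2)
    | op o d a b =>
      exact Reaches.of_step (by simp only [step, h0]; rw [Config.write_of_lt h.1]) (ih ht h.2)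
    | load d a =>
      exact Reaches.of_step (by simp only [step, h0]; rw [Config.write_of_lt h.1]) (ih ht h.2)
    | store a s => exact Reaches.of_step (by simp only [step, h0]) (ih ht h)
    | _ => exact h.elim

/-- The code, at position `q`, that repeats `body` while register `i` is less than register `b`. -/
def loop (i b : ℕ) (body : List Instr) (q : ℕ) : List Instr :=
  [.jlt i b (q + 2), .jmp (q + (body.length + 3))] ++ (body ++ [.jmp q])

theorem length_loop (i b : ℕ) (body : List Instr) (q : ℕ) :
    (loop i b body q).length = body.length + 3 := by
  simp [loop]

/-- The invariant is indexed by the number of completed rounds. A round costs the body, the test and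
the jump back; the last `2` pays for the failing test and the exit. -/
theorem Reaches.of_loop {P : Program} {w i b q N : ℕ} {body : List Instr}
    {I : ℕ → (ℕ → ℕ) → (ℕ → ℕ) → Prop} (hc : CodeAt P q (loop i b body q))
    (hlt : ∀ t < N, ∀ r m, I t r m → r i < r b ∧ Wp w body r m (I (t + 1)))
    (hge : ∀ r m, I N r m → r b ≤ r i) {r m : ℕ → ℕ} (h : I 0 r m) :
    Reaches P w q (q + (loop i b body q).length) (N * (body.length + 2) + 2) r m (I N) := by
  have h0 : P[q]? = some (.jlt i b (q + 2)) := by simpa [loop] using hc 0 (by simp [loop])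
  have h1 : P[q + 1]? = some (.jmp (q + (body.length + 3))) := by
    simpa [loop] using hc 1 (by simp [loop])
  have hbody : CodeAt P (q + 2) body := hc.right.left
  have hlast : P[q + 2 + body.length]? = some (.jmp q) := by
    simpa using hc.right.right 0 (by simp)
  have hexit : ∀ r m, I N r m → Reaches P w q (q + (body.length + 3)) 2 r m (I N) :=
    fun r m hI => by
      refine Reaches.of_step (T := 1) (q' := q + 1) (r' := r) (m' := m) ?_
        (Reaches.of_step (T := 0) (q' := q + (body.length + 3)) (r' := r) (m' := m) ?_
          ⟨0, le_rfl, r, m, rfl, hI⟩)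
      · simp only [step, h0, if_neg (not_lt.2 (hge r m hI))]
      · simp only [step, h1]
  rw [length_loop]
  suffices ∀ d t, t + d = N → ∀ r m, I t r m →
      Reaches P w q (q + (body.length + 3)) (d * (body.length + 2) + 2) r m (I N) from
    this N 0 (by omega) r m h
  intro d
  induction d with
  | zero =>
    rintro t rfl r m hI
    exact (hexit r m hI).mono (by omega) fun _ _ h => h
  | succ d ih =>
    intro t ht r m hI
    obtain ⟨hr, hw⟩ := hlt t (by omega) r m hI
    have e : (d + 1) * (body.length + 2) + 2
        = body.length + (d * (body.length + 2) + 2 + 1) + 1 := by ring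
    rw [e]
    refine Reaches.of_step (q' := q + 2) (r' := r) (m' := m) ?_
      ((Reaches.of_wp hbody hw).trans fun r' m' hI' => ?_)
    · simp only [step, h0, if_pos hr]
    · exact Reaches.of_step (q' := q) (r' := r') (m' := m') (by simp only [step, hlast])
        (ih (t + 1) (by omega) r' m' hI')

/-! ### Writing lists into memory -/

/-- The memory after the list has been written to the addresses `o`, `o + s`, `o + 2 * s`, ... -/
def writeList (m : ℕ → ℕ) (o s : ℕ) : List ℕ → ℕ → ℕ
  | [] => m
  | a :: l => writeList (Function.update m o a) (o + s) s l

theorem writeList_append (m : ℕ → ℕ) (o s : ℕ) (l l' : List ℕ) :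
    writeList m o s (l ++ l') = writeList (writeList m o s l) (o + s * l.length) s l' := by
  induction l generalizing m o with
  | nil => simp [writeList]
  | cons a l ih =>
    simp only [List.cons_append, writeList, ih, List.length_cons]
    congr 1
    ring

theorem writeList_of_ne (m : ℕ → ℕ) (o s : ℕ) (l : List ℕ) {x : ℕ}
    (h : ∀ i < l.length, x ≠ o + s * i) : writeList m o s l x = m x := by
  induction l generalizing m o with
  | nil => rfl
  | cons a l ih =>
    rw [writeList, ih]
    · exact Function.update_of_ne (by simpa using h 0 (by simp)) _ _
    · intro i hi
      have := h (i + 1) (by simpa using hi)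
      rwa [show o + s * (i + 1) = o + s + s * i by ring] at this

theorem writeList_of_lt (m : ℕ → ℕ) (o s : ℕ) (l : List ℕ) {x : ℕ} (h : x < o) :
    writeList m o s l x = m x :=
  writeList_of_ne m o s l fun i _ => by
    have := Nat.zero_le (s * i)
    omega

theorem writeList_apply (m : ℕ → ℕ) (o : ℕ) {s : ℕ} (hs : 0 < s) (l : List ℕ) {i : ℕ}
    (hi : i < l.length) : writeList m o s l (o + s * i) = l[i] := by
  induction l generalizing m o i with
  | nil => simp at hi
  | cons a l ih =>
    cases i with
    | zero =>
      rw [writeList, writeList_of_lt _ _ _ _ (by omega)]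
      simp
    | succ i =>
      rw [writeList, show o + s * (i + 1) = o + s + s * i by ring, ih]
      rfl

end WordRAM

/-! ### The output of the reduction -/

/-- The three numbers attached to a position `p` in the list of endpoints of edges: `p` itself,
the representative of the vertex at `p`, and the one of the other endpoint of the edge. -/
inductive Kind where
  | self | tail | head

/-- The last position `p < t` with `L p = v`, or `0`. -/
def lastIdx (L : ℕ → ℕ) : ℕ → ℕ → ℕ
  | 0, _ => 0
  | t + 1, v => if v = L t then t else lastIdx L t v

theorem lastIdx_le (L : ℕ → ℕ) (t v : ℕ) : lastIdx L t v ≤ t := by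
  induction t with
  | zero => rfl
  | succ t ih => rw [lastIdx]; split_ifs <;> omega

theorem apply_lastIdx (L : ℕ → ℕ) {t p : ℕ} (h : p < t) : L (lastIdx L t (L p)) = L p := by
  induction t with
  | zero => omega
  | succ t ih =>
    rw [lastIdx]
    split_ifs with hp
    · exact hp.symm
    · exact ih (lt_of_le_of_ne (by omega) fun e => hp (by rw [e]))

/-- Flipping the lowest bit exchanges positions `2 * i` and `2 * i + 1`, the two endpoints of one
edge. -/
theorem xor_one_eq (p : ℕ) : p ^^^ 1 = p + 1 - 2 * (p % 2) := by
  have h1 : (p ^^^ 1) / 2 = p / 2 := by rw [Nat.xor_div_two]; simp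
  have h2 : (p ^^^ 1) % 2 = (p + 1) % 2 := by rw [Nat.xor_mod_two_eq]
  omega

theorem xor_one_lt {p m : ℕ} (h : p < 2 * m) : p ^^^ 1 < 2 * m := by
  rw [xor_one_eq]; omega

namespace Kind

/-- The number of the given kind, when `L` lists the endpoints of `m` edges. -/
def val (L : ℕ → ℕ) (m : ℕ) : Kind → ℕ → ℕ
  | self, p => p
  | tail, p => lastIdx L (2 * m) (L p)
  | head, p => lastIdx L (2 * m) (L (p ^^^ 1))

/-- Layers have `2 * m + 1` elements rather than `2 * m`, so that they are nonempty even if there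
are no edges. -/
theorem val_lt (L : ℕ → ℕ) {m : ℕ} (κ : Kind) {p : ℕ} (h : p < 2 * m) :
    κ.val L m p < 2 * m + 1 := by
  cases κ
  · exact Nat.lt_succ_of_lt h
  · exact Nat.lt_succ_of_le (lastIdx_le _ _ _)
  · exact Nat.lt_succ_of_le (lastIdx_le _ _ _)

/-- The register that contains the number. -/
def reg : Kind → ℕ
  | self => 7
  | tail => 12
  | head => 13

end Kind

/-- The words that a list of items produces for position `p`. -/
def itemWords (L : ℕ → ℕ) (m : ℕ) (items : List (ℕ × Kind)) (p : ℕ) : List ℕ :=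
  items.map fun it => it.1 * (2 * m + 1) + it.2.val L m p

/-- The first `t` rounds of output. -/
def roundWords (L : ℕ → ℕ) (m k : ℕ) (items : List (ℕ × Kind)) (t : ℕ) : List ℕ :=
  [2 * k * (2 * m + 1), 2 * k * (2 * m)] ++ (List.range t).flatMap (itemWords L m items)

theorem length_roundWords {L : ℕ → ℕ} {m k : ℕ} {items : List (ℕ × Kind)}
    (h : items.length = 4 * k) (t : ℕ) : (roundWords L m k items t).length = 2 + 4 * k * t := by
  simp [roundWords, itemWords, h, List.length_flatMap]
  ring

theorem roundWords_succ (L : ℕ → ℕ) (m k : ℕ) (items : List (ℕ × Kind)) (t : ℕ) :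
    roundWords L m k items (t + 1) = roundWords L m k items t ++ itemWords L m items t := by
  simp [roundWords, List.range_succ]

namespace WordRAM

/-! ### The program of the reduction -/

/-- Store the word `c * N + x`, where `x` is in the register of the kind. -/
def emitWord (it : ℕ × Kind) : List Instr :=
  [.const 10 it.1, .op .mul 10 10 5, .op .add 10 10 it.2.reg, .store 9 10, .op .add 9 9 8]

/-- The constants: `1`, `2`, `2 * m`, `2 * m + 1`, the address of the table, the addresses of
the two outputs, and the stride. -/
def setup (s c₁ c₂ : ℕ) : List Instr :=
  [.const 2 1, .const 3 2, .load 4 2, .op .mul 4 4 3, .op .add 5 4 2, .op .add 6 4 3,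
    .load 10 7, .op .add 0 6 10, .const 8 s, .const 10 c₁, .op .mul 10 10 4, .op .add 1 0 10,
    .const 10 c₂, .op .add 1 1 10]

/-- Record position `p` as the last occurrence of the vertex at `p`. -/
def tableBody : List Instr :=
  [.op .add 10 7 3, .load 10 10, .op .add 10 10 6, .store 10 7, .op .add 7 7 2]

/-- The header of an output graph. -/
def emitHeader (k ob : ℕ) : List Instr :=
  [.const 7 0, .op .add 9 ob 7, .const 10 (2 * k), .op .mul 10 10 5, .store 9 10, .op .add 9 9 8,
    .const 10 (2 * k), .op .mul 10 10 4, .store 9 10, .op .add 9 9 8]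

/-- Look up the two representatives for position `p`. -/
def lookup : List Instr :=
  [.op .add 12 7 3, .load 12 12, .op .add 12 12 6, .load 12 12,
    .op .xor 13 7 2, .op .add 13 13 3, .load 13 13, .op .add 13 13 6, .load 13 13]

/-- The output for position `p`. -/
def emitBody (items : List (ℕ × Kind)) : List Instr :=
  lookup ++ (items.flatMap emitWord ++ [.op .add 7 7 2])

theorem length_emitBody {k : ℕ} {items : List (ℕ × Kind)} (h : items.length = 4 * k) :
    (emitBody items).length = 20 * k + 10 := by
  simp [emitBody, lookup, emitWord, List.length_flatMap, h]
  ring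

/-- Append the code that outputs a graph. -/
def emitAfter (k ob : ℕ) (items : List (ℕ × Kind)) (P : Program) : Program :=
  (P ++ emitHeader k ob) ++ loop 7 4 (emitBody items) (P ++ emitHeader k ob).length

/-- The code that fills the table. -/
def tableCode (s c₁ c₂ : ℕ) : Program :=
  setup s c₁ c₂ ++ loop 7 4 tableBody (setup s c₁ c₂).length

/-- The program of the reduction. -/
def reduction (k s c₁ c₂ : ℕ) (items items' : List (ℕ × Kind)) : Program :=
  emitAfter k 1 items' (emitAfter k 0 items (tableCode s c₁ c₂))

/-- The contents of the constant registers. -/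
structure Regs (m s b₁ b₂ : ℕ) (r : ℕ → ℕ) : Prop where
  one : r 2 = 1
  two : r 3 = 2
  dbl : r 4 = 2 * m
  width : r 5 = 2 * m + 1
  table : r 6 = 2 * m + 2
  stride : r 8 = s
  out₁ : r 0 = b₁
  out₂ : r 1 = b₂
  high : ∀ x, 16 ≤ x → r x = 0

/-- The exceptions are the working registers: position `7`, write address `9`, scratch `10`,
representatives `12` and `13`. -/
theorem Regs.congr {m s b₁ b₂ : ℕ} {r r' : ℕ → ℕ} (h : Regs m s b₁ b₂ r)
    (hr : ∀ x, x ≠ 7 → x ≠ 9 → x ≠ 10 → x ≠ 12 → x ≠ 13 → r' x = r x) : Regs m s b₁ b₂ r' := by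
  constructor
  any_goals rw [hr _ (by decide) (by decide) (by decide) (by decide) (by decide)]
  · exact h.one
  · exact h.two
  · exact h.dbl
  · exact h.width
  · exact h.table
  · exact h.stride
  · exact h.out₁
  · exact h.out₂
  · intro x hx
    rw [hr x (by omega) (by omega) (by omega) (by omega) (by omega)]
    exact h.high x hx

theorem wp_append {w : ℕ} {l l' : List Instr} {r m : ℕ → ℕ}
    {Q : (ℕ → ℕ) → (ℕ → ℕ) → Prop} (h : Wp w l r m fun r' m' => Wp w l' r' m' Q) :
    Wp w (l ++ l') r m Q := by
  induction l generalizing r m with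
  | nil => exact h
  | cons I l ih =>
    cases I with
    | store a s => exact ih h
    | const | op | load => exact ⟨h.1, ih h.2⟩
    | _ => exact h.elim

theorem wp_emit {w : ℕ} (items : List (ℕ × Kind)) {r m : ℕ → ℕ}
    {Q : (ℕ → ℕ) → (ℕ → ℕ) → Prop}
    (hb : ∀ it ∈ items, it.1 < 2 ^ w ∧ it.1 * r 5 + r it.2.reg < 2 ^ w)
    (ho : r 9 + r 8 * items.length < 2 ^ w)
    (hQ : ∀ r', (∀ x, x ≠ 9 → x ≠ 10 → r' x = r x) → r' 9 = r 9 + r 8 * items.length →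
      Q r' (writeList m (r 9) (r 8) (items.map fun it => it.1 * r 5 + r it.2.reg))) :
    Wp w (items.flatMap emitWord) r m Q := by
  induction items generalizing r m with
  | nil => exact hQ r (fun _ _ _ => rfl) (by simp)
  | cons it l ih =>
    rw [List.flatMap_cons]
    have hreg : it.2.reg ≠ 10 ∧ it.2.reg ≠ 9 := by cases it.2 <;> decide
    have hreg' : ∀ κ : Kind, κ.reg ≠ 10 ∧ κ.reg ≠ 9 := fun κ => by cases κ <;> decide
    obtain ⟨h1, h2⟩ := hb it (by simp)
    rw [List.length_cons, Nat.mul_succ] at ho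
    refine wp_append ?_
    simp only [emitWord, Wp, BinOp.eval, Function.update_apply, if_true, if_neg hreg.1]
    simp only [show (5 : ℕ) ≠ 10 by decide, show (9 : ℕ) ≠ 10 by decide,
      show (8 : ℕ) ≠ 10 by decide, if_false]
    refine ⟨h1, by omega, h2, by omega, ?_⟩
    have e : ∀ x, x ≠ 9 → x ≠ 10 → (Function.update (Function.update (Function.update
        (Function.update r 10 it.1) 10 (it.1 * r 5)) 10 (it.1 * r 5 + r it.2.reg)) 9
        (r 9 + r 8)) x = r x := fun x h9 h10 => by simp [h9, h10]
    have e9 : (Function.update (Function.update (Function.update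
        (Function.update r 10 it.1) 10 (it.1 * r 5)) 10 (it.1 * r 5 + r it.2.reg)) 9
        (r 9 + r 8)) 9 = r 9 + r 8 := by simp
    generalize (Function.update (Function.update (Function.update
        (Function.update r 10 it.1) 10 (it.1 * r 5)) 10 (it.1 * r 5 + r it.2.reg)) 9
        (r 9 + r 8)) = r₁ at e e9
    have e5 := e 5 (by decide) (by decide)
    have e8 := e 8 (by decide) (by decide)
    have eκ : ∀ κ : Kind, r₁ κ.reg = r κ.reg := fun κ => e _ (hreg' κ).2 (hreg' κ).1
    refine ih (fun it' h' => ?_) (by rw [e9, e8]; omega) fun r' hr' hr9 => ?_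
    · rw [e5, eκ]
      exact hb it' (by simp [h'])
    · have := hQ r' (fun x h9 h10 => (hr' x h9 h10).trans (e x h9 h10)) (by
        rw [hr9, e9, e8, List.length_cons, Nat.mul_succ]; omega)
      simpa only [List.map_cons, writeList, e9, e8, e5, eκ] using this

/-- The memory after `t` rounds of filling the table. -/
def tableMem (n m : ℕ) (L inp : ℕ → ℕ) (t x : ℕ) : ℕ :=
  if 2 * m + 2 ≤ x ∧ x < 2 * m + 2 + n then lastIdx L t (x - (2 * m + 2)) else inp x

/-- Overwriting an entry at each occurrence leaves the last one. -/
theorem tableMem_succ {n m : ℕ} {L inp : ℕ → ℕ} {t : ℕ} (h : L t < n) :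
    tableMem n m L inp (t + 1)
      = Function.update (tableMem n m L inp t) (L t + (2 * m + 2)) t := by
  funext x
  by_cases hx : x = L t + (2 * m + 2)
  · subst hx
    simp [tableMem, lastIdx, h, add_comm]
  · rw [Function.update_of_ne hx]
    unfold tableMem
    split_ifs with h'
    · rw [lastIdx, if_neg (by omega)]
    · rfl

/-! ### Correctness of the code of the reduction -/

theorem reaches_tableCode {P : Program} {w n m k s c₁ c₂ : ℕ} {L inp : ℕ → ℕ}
    (hc : CodeAt P 0 (tableCode s c₁ c₂)) (hs : s ≤ 2) (hc₁ : c₁ ≤ 4 * k) (hc₂ : c₂ ≤ 2)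
    (hw : n + 16 * ((k + 1) * (2 * m + 1)) ≤ 2 ^ w)
    (h0 : inp 0 = n) (h1 : inp 1 = m) (hL : ∀ p < 2 * m, inp (p + 2) = L p ∧ L p < n)
    (hz : ∀ x, 2 * m + 2 ≤ x → inp x = 0) :
    Reaches P w 0 (tableCode s c₁ c₂).length (16 + 2 * m * 7) (fun _ => 0) inp fun r m' =>
      Regs m s (2 * m + 2 + n) (2 * m + 2 + n + c₁ * (2 * m) + c₂) r ∧
        m' = tableMem n m L inp (2 * m) := by
  have hk : (k + 1) * (2 * m + 1) = 2 * (k * m) + k + 2 * m + 1 := by ring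
  have hcm : c₁ * (2 * m) ≤ 8 * (k * m) := by nlinarith [Nat.mul_le_mul_right (2 * m) hc₁]
  rw [hk] at hw
  have hsetup := Reaches.of_wp (P := P) (w := w) (r := fun _ => 0) (m := inp)
    (Q := fun r m' => Regs m s (2 * m + 2 + n) (2 * m + 2 + n + c₁ * (2 * m) + c₂) r ∧ r 7 = 0 ∧
      m' = tableMem n m L inp 0) hc.left (by
    -- Register `7` is still `0` when `setup` loads through it, so this load reads `n`.
    simp only [setup, Wp, BinOp.eval, h0, h1, Function.update_self, ne_eq,
      not_false_eq_true, Function.update_of_ne, Nat.reduceEqDiff,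
      OfNat.ofNat_ne_zero, OfNat.zero_ne_ofNat, OfNat.one_ne_ofNat, OfNat.ofNat_ne_one]
    rw [mul_comm m 2]
    refine ⟨by omega, by omega, by omega, by omega, by omega, by omega, by omega, by omega,
      by omega, by omega, by omega, by omega, by omega, by omega, ?_, ?_, ?_⟩
    · constructor <;> simp
      intro x hx
      simp (disch := omega) only [Function.update_of_ne]
    · simp
    · funext x
      unfold tableMem
      split_ifs with hx
      -- `lastIdx` is `0` before the first round, like the untouched memory. The table of `n`
      -- entries needs no initialisation, which keeps `n` out of the running time.
      · exact hz x hx.1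
      · rfl)
  have hlen : (setup s c₁ c₂).length = 14 := rfl
  rw [zero_add] at hsetup
  have hc' := hc.right
  rw [zero_add] at hc'
  have e : (tableCode s c₁ c₂).length
      = (setup s c₁ c₂).length + (loop 7 4 tableBody (setup s c₁ c₂).length).length := by
    simp [tableCode]
  rw [e]
  refine Reaches.mono (T := 14 + (2 * m * (5 + 2) + 2)) (hsetup.trans fun r m' hI =>
    (Reaches.of_loop (I := fun t r m' => Regs m s (2 * m + 2 + n)
      (2 * m + 2 + n + c₁ * (2 * m) + c₂) r ∧ r 7 = t ∧ m' = tableMem n m L inp t) hc' ?_ ?_ hI))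
    (by omega) fun _ _ h => ⟨h.1, h.2.2⟩
  · rintro t ht r m' ⟨hR, h7, rfl⟩
    obtain ⟨hLt, hLn⟩ := hL t ht
    refine ⟨by rw [h7, hR.dbl]; exact ht, ?_⟩
    have hm : tableMem n m L inp t (t + 2) = L t := by
      rw [tableMem, if_neg (by omega), hLt]
    have e2 := hR.one
    have e3 := hR.two
    have e6 := hR.table
    simp only [tableBody, Wp, BinOp.eval, Function.update_self, ne_eq,
      not_false_eq_true, Function.update_of_ne, Nat.reduceEqDiff, e2, e3, e6, h7, hm]
    refine ⟨by omega, by omega, by omega, by omega, ?_, trivial, (tableMem_succ hLn).symm⟩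
    exact hR.congr fun x h7 h9 h10 h12 h13 => by simp [h7, h10]
  · rintro r m' ⟨hR, h7, -⟩
    rw [h7, hR.dbl]

/-- By `ho` the output lies beyond the input and the table, so the lookups of later rounds are not
disturbed; `ho'` keeps its addresses within a word. -/
theorem reaches_emit {P P₀ : Program} {w n m k s b₁ b₂ ob o : ℕ} {L : ℕ → ℕ}
    {items : List (ℕ × Kind)}
    (hc : CodeAt P 0 (emitAfter k ob items P₀)) (hs : s ≤ 2)
    (hlen : items.length = 4 * k) (hit : ∀ it ∈ items, it.1 < 2 * k)
    (ho : 2 * m + 2 + n ≤ o) (ho' : o ≤ 2 * m + 2 + n + 8 * (k * m) + 2)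
    (hw : n + 16 * ((k + 1) * (2 * m + 1)) ≤ 2 ^ w)
    {r mem : ℕ → ℕ} (hR : Regs m s b₁ b₂ r) (hob : r ob = o) (hob' : ob ≠ 7)
    (hL : ∀ p < 2 * m, mem (p + 2) = L p ∧ L p < n)
    (htab : ∀ v < n, mem (v + (2 * m + 2)) = lastIdx L (2 * m) v) :
    Reaches P w P₀.length (emitAfter k ob items P₀).length (12 + 2 * m * (20 * k + 12)) r mem
      fun r' m' => Regs m s b₁ b₂ r' ∧
        m' = writeList mem o s (roundWords L m k items (2 * m)) := by
  have hk : (k + 1) * (2 * m + 1) = 2 * (k * m) + k + 2 * m + 1 := by ring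
  have hk2 : 2 * k * (2 * m + 1) = 4 * (k * m) + 2 * k := by ring
  have hk3 : 2 * k * (2 * m) = 4 * (k * m) := by ring
  rw [hk] at hw
  have hhead := Reaches.of_wp (P := P) (w := w) (r := r) (m := mem) (q := P₀.length)
    (l := emitHeader k ob)
    (Q := fun r m' => Regs m s b₁ b₂ r ∧ r 7 = 0 ∧ r 9 = o + s * (2 + 4 * k * 0) ∧
      m' = writeList mem o s (roundWords L m k items 0))
    (by simpa using hc.left.right) (by
      have e5 := hR.width
      have e4 := hR.dbl
      have e8 := hR.stride
      simp only [emitHeader, Wp, BinOp.eval, Function.update_self, ne_eq, hob',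
        not_false_eq_true, Function.update_of_ne, Nat.reduceEqDiff, e4, e5, e8, hob, add_zero]
      refine ⟨by omega, by omega, by omega, by omega, by omega, by omega, by omega, by omega, ?_,
        trivial, by ring, rfl⟩
      exact hR.congr fun x h7 h9 h10 h12 h13 => by simp [h7, h9, h10])
  have hc' := hc.right
  rw [zero_add] at hc'
  have e : (emitAfter k ob items P₀).length = P₀.length + (emitHeader k ob).length +
      (loop 7 4 (emitBody items) (P₀ ++ emitHeader k ob).length).length := by
    simp [emitAfter, add_assoc]
  have hlh : (emitHeader k ob).length = 10 := rfl
  rw [e]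
  rw [List.length_append] at hc' ⊢
  have hbl := length_emitBody hlen
  refine Reaches.mono (T := 10 + (2 * m * ((emitBody items).length + 2) + 2))
    (hhead.trans fun r m' hI =>
    (Reaches.of_loop (I := fun t r m' => Regs m s b₁ b₂ r ∧ r 7 = t ∧
      r 9 = o + s * (2 + 4 * k * t) ∧ m' = writeList mem o s (roundWords L m k items t))
      hc' ?_ ?_ hI))
    (by rw [hbl, show 20 * k + 10 + 2 = 20 * k + 12 from rfl]; omega) fun _ _ h => ⟨h.1, h.2.2.2⟩
  · rintro t ht r m' ⟨hR, h7, h9, rfl⟩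
    refine ⟨by rw [h7, hR.dbl]; exact ht, ?_⟩
    have hx := xor_one_lt ht
    have hmem : ∀ x, x < o → writeList mem o s (roundWords L m k items t) x = mem x :=
      fun x hx => writeList_of_lt _ _ _ _ hx
    have hm : ∀ p < 2 * m, writeList mem o s (roundWords L m k items t) (p + 2) = L p :=
      fun p hp => by rw [hmem _ (by omega), (hL p hp).1]
    have hm' : ∀ p < 2 * m, writeList mem o s (roundWords L m k items t) (L p + (2 * m + 2))
        = lastIdx L (2 * m) (L p) :=
      fun p hp => by rw [hmem _ (by have := (hL p hp).2; omega), htab _ (hL p hp).2]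
    have e2 := hR.one
    have e3 := hR.two
    have e6 := hR.table
    have hl1 := lastIdx_le L (2 * m) (L t)
    have hl2 := lastIdx_le L (2 * m) (L (t ^^^ 1))
    have hL1 := (hL t ht).2
    have hL2 := (hL _ hx).2
    have hkt' : k * (t + 1) ≤ k * m * 2 := by
      calc k * (t + 1) ≤ k * (2 * m) := Nat.mul_le_mul_left _ ht
        _ = _ := by ring
    have hst : s * (2 + 4 * k * t) + s * (4 * k) ≤ 2 * (2 + 8 * (k * m)) := by
      calc _ = s * (2 + 4 * (k * (t + 1))) := by ring
        _ ≤ _ := Nat.mul_le_mul hs (by omega)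
    refine wp_append ?_
    simp only [lookup, Wp, BinOp.eval, Function.update_self, ne_eq,
      not_false_eq_true, Function.update_of_ne, Nat.reduceEqDiff, e2, e3, e6, h7, hm t ht,
      hm' t ht, hm _ hx, hm' _ hx]
    refine ⟨by omega, by omega, by omega, by omega, by omega, by omega, by omega, by omega,
      by omega, ?_⟩
    generalize hr₁ : Function.update (β := fun _ => ℕ) _ 13 (lastIdx L (2 * m) (L (t ^^^ 1))) = r₁
    have h12 : r₁ 12 = lastIdx L (2 * m) (L t) := by simp [← hr₁]
    have h13 : r₁ 13 = lastIdx L (2 * m) (L (t ^^^ 1)) := by simp [← hr₁]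
    have hκ : ∀ κ : Kind, r₁ κ.reg = κ.val L m t := by
      rintro (_ | _ | _)
      · rw [Kind.reg, ← h7]
        simp [← hr₁, Kind.val, h7]
      · exact h12
      · exact h13
    have hr : ∀ x, x ≠ 12 → x ≠ 13 → r₁ x = r x := fun x hx hy => by simp [← hr₁, hx, hy]
    have f5 : r₁ 5 = 2 * m + 1 := (hr 5 (by decide) (by decide)).trans hR.width
    have f8 : r₁ 8 = s := (hr 8 (by decide) (by decide)).trans hR.stride
    have f9 : r₁ 9 = o + s * (2 + 4 * k * t) := (hr 9 (by decide) (by decide)).trans h9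
    refine wp_append (wp_emit items (fun it h => ?_) ?_ fun r' hr' hr9 => ?_)
    · have h1 := hit it h
      have h2 : (it.1 + 1) * (2 * m + 1) ≤ 2 * k * (2 * m + 1) := Nat.mul_le_mul_right _ h1
      have h3 := it.2.val_lt L ht
      rw [hκ, f5]
      rw [Nat.succ_mul] at h2
      omega
    · rw [f9, f8, hlen]
      omega
    · simp only [Wp, BinOp.eval]
      rw [hr' 7 (by decide) (by decide), hr' 2 (by decide) (by decide),
        hr 7 (by decide) (by decide), hr 2 (by decide) (by decide), e2, h7]
      refine ⟨by omega, ?_, by simp, ?_, ?_⟩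
      · exact hR.congr fun x x7 x9 x10 x12 x13 => by
          rw [Function.update_of_ne x7, hr' x x9 x10, hr x x12 x13]
      · rw [Function.update_of_ne (by decide), hr9, f9, f8, hlen]
        ring
      · rw [roundWords_succ, writeList_append, length_roundWords hlen, f9, f8, f5, itemWords]
        simp only [hκ]
  · rintro r m' ⟨hR, h7, -⟩
    rw [h7, hR.dbl]

/-- The second pass rereads the input and the table, both below the first output. Describing memory
by nested writes covers consecutive and interleaved outputs at once. -/
theorem reaches_reduction {P : Program} {w n m k s c₁ c₂ : ℕ} {L inp : ℕ → ℕ}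
    {items items' : List (ℕ × Kind)}
    (hc : CodeAt P 0 (reduction k s c₁ c₂ items items'))
    (hs : s ≤ 2) (hc₁ : c₁ ≤ 4 * k) (hc₂ : c₂ ≤ 2)
    (hlen : items.length = 4 * k) (hit : ∀ it ∈ items, it.1 < 2 * k)
    (hlen' : items'.length = 4 * k) (hit' : ∀ it ∈ items', it.1 < 2 * k)
    (hw : n + 16 * ((k + 1) * (2 * m + 1)) ≤ 2 ^ w)
    (h0 : inp 0 = n) (h1 : inp 1 = m) (hL : ∀ p < 2 * m, inp (p + 2) = L p ∧ L p < n)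
    (hz : ∀ x, 2 * m + 2 ≤ x → inp x = 0) :
    Reaches P w 0 (reduction k s c₁ c₂ items items').length (80 * ((k + 1) * (2 * m + 1)))
      (fun _ => 0) inp fun r m' =>
      Regs m s (2 * m + 2 + n) (2 * m + 2 + n + c₁ * (2 * m) + c₂) r ∧
        m' = writeList (writeList (tableMem n m L inp (2 * m))
          (2 * m + 2 + n) s (roundWords L m k items (2 * m)))
          (2 * m + 2 + n + c₁ * (2 * m) + c₂) s (roundWords L m k items' (2 * m)) := by
  have hcm : c₁ * (2 * m) ≤ 8 * (k * m) := by nlinarith [Nat.mul_le_mul_right (2 * m) hc₁]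
  refine Reaches.mono (((reaches_tableCode hc.left.left.left.left hs hc₁ hc₂ hw h0 h1 hL hz).trans
    (q'' := (emitAfter k 0 items (tableCode s c₁ c₂)).length)
    (T' := 12 + 2 * m * (20 * k + 12)) (Q' := fun r m' =>
      Regs m s (2 * m + 2 + n) (2 * m + 2 + n + c₁ * (2 * m) + c₂) r ∧
        m' = writeList (tableMem n m L inp (2 * m))
          (2 * m + 2 + n) s (roundWords L m k items (2 * m))) ?_).trans
    (T' := 12 + 2 * m * (20 * k + 12)) ?_) (by ring_nf; omega) fun _ _ h => h
  · rintro r mem ⟨hR, rfl⟩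
    refine reaches_emit hc.left.left hs hlen hit le_rfl (by omega) hw hR hR.out₁ (by decide)
      (fun p hp => ⟨?_, (hL p hp).2⟩) fun v hv => ?_
    · rw [tableMem, if_neg (by omega), (hL p hp).1]
    · rw [tableMem, if_pos (by omega), Nat.add_sub_cancel]
  · rintro r mem ⟨hR, rfl⟩
    refine reaches_emit hc hs hlen' hit' (by omega) (by omega) hw hR hR.out₂ (by decide)
      (fun p hp => ⟨?_, (hL p hp).2⟩) fun v hv => ?_
    · rw [writeList_of_lt _ _ _ _ (by omega), tableMem, if_neg (by omega), (hL p hp).1]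
    · rw [writeList_of_lt _ _ _ _ (by omega), tableMem, if_pos (by omega), Nat.add_sub_cancel]

end WordRAM

/-! ### Closed walks in two-fold lifts -/

open SimpleGraph

/-- Homomorphisms from a cycle are closed walks. -/
def cycleHomEquiv {V : Type*} (G : SimpleGraph V) (n : ℕ) :
    (cycleGraph (n + 2) →g G) ≃ {f : Fin (n + 2) → V // ∀ i, G.Adj (f i) (f (i + 1))} where
  toFun f := ⟨f, fun i => f.map_adj (cycleGraph_adj.2 (Or.inr (by abel)))⟩
  invFun f := ⟨f.1, fun {a b} h => by
    rcases cycleGraph_adj.1 h with h | h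
    · obtain rfl : a = b + 1 := by rw [← h]; abel
      exact (f.2 b).symm
    · obtain rfl : b = a + 1 := by rw [← h]; abel
      exact f.2 a⟩
  left_inv _ := rfl
  right_inv _ := rfl

theorem homCount_cycleGraph {V : Type*} (G : SimpleGraph V) (n : ℕ) :
    homCount (cycleGraph (n + 2)) G
      = {f : Fin (n + 2) → V | ∀ i, G.Adj (f i) (f (i + 1))}.ncard :=
  Nat.card_congr (cycleHomEquiv G n)

theorem homCount_congr {U V W : Type*} (H : SimpleGraph U) {G : SimpleGraph V}
    {G' : SimpleGraph W} (e : G ≃g G') : homCount H G = homCount H G' :=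
  Nat.card_congr
    { toFun := fun f => e.toHom.comp f
      invFun := fun f => e.symm.toHom.comp f
      left_inv := fun f => by ext x; simp
      right_inv := fun f => by ext x; simp }

/-- The two-fold lift of a graph given by a `ZMod 2`-valued function on its edges. -/
def twoLift {X : Type*} (B : SimpleGraph X) (χ : X → X → ZMod 2) (hχ : ∀ x y, χ x y = χ y x) :
    SimpleGraph (ZMod 2 × X) where
  Adj a b := B.Adj a.2 b.2 ∧ b.1 = a.1 + χ a.2 b.2
  symm := ⟨fun a b h =>
    ⟨h.1.symm, by rw [h.2, hχ b.2, add_assoc, CharTwo.add_self_eq_zero, add_zero]⟩⟩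
  loopless := ⟨fun a h => B.loopless.irrefl _ h.1⟩

/-- The holonomy of a closed walk. -/
def holonomy {X : Type*} (χ : X → X → ZMod 2) {n : ℕ} (ψ : Fin (n + 2) → X) : ZMod 2 :=
  ∑ i, χ (ψ i) (ψ (i + 1))

theorem sum_shift {M : Type*} [AddCommMonoid M] {n : ℕ} (f : Fin (n + 2) → M) :
    ∑ i, f (i + 1) = ∑ i, f i :=
  Equiv.sum_comp (Equiv.addRight (1 : Fin (n + 2))) f

/-- Unique path lifting: a walk in the lift is a walk in the base with a starting sheet, and it
closes up iff the holonomy vanishes. -/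
theorem ncard_closed_twoLift {X : Type*} (B : SimpleGraph X)
    (χ : X → X → ZMod 2) (hχ : ∀ x y, χ x y = χ y x) (n : ℕ) :
    {φ : Fin (n + 2) → ZMod 2 × X | ∀ i, (twoLift B χ hχ).Adj (φ i) (φ (i + 1))}.ncard
      = 2 * {ψ : Fin (n + 2) → X | (∀ i, B.Adj (ψ i) (ψ (i + 1))) ∧ holonomy χ ψ = 0}.ncard := by
  have h2 : (Set.univ : Set (ZMod 2)).ncard = 2 := by
    rw [Set.ncard_univ, Nat.card_eq_fintype_card, ZMod.card]
  have hprod : ∀ S : Set (Fin (n + 2) → X), 2 * S.ncard = ((Set.univ : Set (ZMod 2)) ×ˢ S).ncard :=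
    fun S => by rw [Set.ncard_prod, h2]
  rw [hprod]
  refine Set.ncard_congr (fun φ _ => ((φ 0).1, fun i => (φ i).2)) ?_ ?_ ?_
  · intro φ hφ
    refine ⟨trivial, fun i => (hφ i).1, ?_⟩
    have : ∑ i, (φ (i + 1)).1 = ∑ i, (φ i).1 + holonomy χ fun i => (φ i).2 := by
      rw [holonomy, ← Finset.sum_add_distrib]
      exact Finset.sum_congr rfl fun i _ => (hφ i).2
    rw [sum_shift fun i => (φ i).1] at this
    exact left_eq_add.1 this
  · intro φ φ' hφ hφ' h
    have h0 : (φ 0).1 = (φ' 0).1 := (Prod.ext_iff.1 h).1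
    have hs : ∀ i, (φ i).2 = (φ' i).2 := fun i => congrFun (Prod.ext_iff.1 h).2 i
    have h1 : ∀ i, (φ i).1 = (φ' i).1 := fun i => by
      induction i using Fin.induction with
      | zero => exact h0
      | succ i ih =>
        have e := (hφ i.castSucc).2
        have e' := (hφ' i.castSucc).2
        rw [Fin.coeSucc_eq_succ] at e e'
        rw [e, e', ih, hs, hs]
    exact funext fun i => Prod.ext (h1 i) (hs i)
  · rintro ⟨s, ψ⟩ ⟨-, hψ, h0⟩
    -- The sheet at time `i` is the starting one plus all values of `χ` passed before; vanishing
    -- holonomy is needed only for the step from the last index to `0`.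
    refine ⟨fun i => (s + ∑ j with j < i, χ (ψ j) (ψ (j + 1)), ψ i), fun i => ⟨hψ i, ?_⟩, ?_⟩
    · simp only
      rw [add_assoc]
      congr 1
      cases i using Fin.lastCases with
      | last =>
        rw [Fin.last_add_one]
        have e : (Finset.univ.filter fun j : Fin (n + 2) => j < Fin.last (n + 1))
            = Finset.univ.erase (Fin.last (n + 1)) := by
          ext j; simp [Fin.lt_last_iff_ne_last]
        rw [e, ← Fin.last_add_one, Finset.sum_erase_add _ _ (Finset.mem_univ _), Fin.last_add_one]
        simpa [holonomy] using h0.symm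
      | cast i =>
        rw [Fin.coeSucc_eq_succ]
        have e : (Finset.univ.filter fun j : Fin (n + 2) => j < i.succ)
            = insert i.castSucc (Finset.univ.filter fun j => j < i.castSucc) := by
          ext j
          simp only [Finset.mem_filter, Finset.mem_univ, true_and, Finset.mem_insert, Fin.lt_def,
            Fin.ext_iff, Fin.val_succ, Fin.val_castSucc]
          omega
        rw [e, Finset.sum_insert (by simp), add_comm, Fin.coeSucc_eq_succ]
    · simp

theorem holonomy_zero {X : Type*} {n : ℕ} (ψ : Fin (n + 2) → X) :
    holonomy (fun _ _ => 0) ψ = 0 := by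
  simp [holonomy]

/-- A lift has as many closed walks of a given length as the trivial lift iff all these walks
of the base have trivial holonomy. -/
theorem homCount_twoLift_eq_iff {X : Type*} [Finite X] (B : SimpleGraph X)
    (χ : X → X → ZMod 2) (hχ : ∀ x y, χ x y = χ y x) (n : ℕ) :
    homCount (cycleGraph (n + 2)) (twoLift B (fun _ _ => 0) fun _ _ => rfl)
        = homCount (cycleGraph (n + 2)) (twoLift B χ hχ) ↔
      ∀ ψ : Fin (n + 2) → X, (∀ i, B.Adj (ψ i) (ψ (i + 1))) → holonomy χ ψ = 0 := by
  rw [homCount_cycleGraph, homCount_cycleGraph, ncard_closed_twoLift, ncard_closed_twoLift]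
  simp only [holonomy_zero, and_true]
  constructor
  · intro h ψ hψ
    have := Set.eq_of_subset_of_ncard_le
      (s := {ψ : Fin (n + 2) → X | (∀ i, B.Adj (ψ i) (ψ (i + 1))) ∧ holonomy χ ψ = 0})
      (t := {ψ : Fin (n + 2) → X | ∀ i, B.Adj (ψ i) (ψ (i + 1))}) (fun ψ h => h.1) (by omega)
    exact ((Set.ext_iff.1 this ψ).2 hψ).2
  · intro h
    congr 2
    ext ψ
    exact ⟨fun hψ => ⟨hψ, h ψ hψ⟩, fun hψ => hψ.1⟩

/-! ### Cyclically layered graphs -/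

/-- The graph with layers indexed by `Fin (n + 2)`, where `R j` is the adjacency between
layers `j` and `j + 1`. -/
def layered {P : Type*} {n : ℕ} (R : Fin (n + 2) → P → P → Prop) :
    SimpleGraph (Fin (n + 2) × P) where
  Adj a b := (b.1 = a.1 + 1 ∧ R a.1 a.2 b.2) ∨ (a.1 = b.1 + 1 ∧ R b.1 b.2 a.2)
  symm := ⟨fun _ _ h => h.symm⟩
  loopless := ⟨fun a h => by
    have : a.1 = a.1 + 1 := h.elim And.left And.left
    simp at this⟩

/-- The edges between the last layer and the first one are twisted. -/
def twist {P : Type*} {n : ℕ} (a b : Fin (n + 2) × P) : ZMod 2 :=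
  if (a.1 = Fin.last (n + 1) ∧ b.1 = 0) ∨ (b.1 = Fin.last (n + 1) ∧ a.1 = 0) then 1 else 0

theorem twist_symm {P : Type*} {n : ℕ} (a b : Fin (n + 2) × P) : twist a b = twist b a := by
  unfold twist
  simp only [or_comm]

/-- Cyclic successor lifted to `ℤ`: the correction term records a passage over the seam, so that its
signed sum becomes a winding number. -/
theorem val_add_one_eq {n : ℕ} (j : Fin (n + 2)) :
    ((j + 1 : Fin (n + 2)).val : ℤ)
      = j.val + 1 - (n + 2) * if j = Fin.last (n + 1) then 1 else 0 := by
  cases j using Fin.lastCases with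
  | last => simp; ring
  | cast j => rw [Fin.coeSucc_eq_succ]; simp [j.castSucc_lt_last.ne]

/-- Three layers are needed: with only two, the step from `0` to `1` would join the first and the
last layer as well. -/
theorem twist_up {P : Type*} {n : ℕ} (hn : 1 ≤ n) {a b : Fin (n + 2) × P} (h : b.1 = a.1 + 1) :
    twist a b = if a.1 = Fin.last (n + 1) then 1 else 0 := by
  unfold twist
  by_cases ha : a.1 = Fin.last (n + 1)
  · rw [if_pos ha, if_pos]
    exact Or.inl ⟨ha, by rw [h, ha, Fin.last_add_one]⟩
  · rw [if_neg ha, if_neg]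
    rintro (⟨h1, -⟩ | ⟨h1, h2⟩)
    · exact ha h1
    · rw [h, h2, zero_add] at h1
      have := congrArg Fin.val h1
      simp at this
      omega

/-- A closed walk with nontrivial holonomy, the length of which is the number of layers, visits
the layers in cyclic order. -/
theorem exists_holonomy_ne_zero_iff {P : Type*} {n : ℕ} (hn : 1 ≤ n)
    (R : Fin (n + 2) → P → P → Prop) :
    (∃ ψ : Fin (n + 2) → Fin (n + 2) × P,
        (∀ i, (layered R).Adj (ψ i) (ψ (i + 1))) ∧ holonomy twist ψ ≠ 0) ↔
      ∃ p : Fin (n + 2) → P, ∀ j, R j (p j) (p (j + 1)) := by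
  classical
  constructor
  · rintro ⟨ψ, hψ, h0⟩
    let Up : Fin (n + 2) → Prop := fun i =>
      (ψ (i + 1)).1 = (ψ i).1 + 1 ∧ R (ψ i).1 (ψ i).2 (ψ (i + 1)).2
    have hdown : ∀ i, ¬ Up i →
        (ψ i).1 = (ψ (i + 1)).1 + 1 ∧ R (ψ (i + 1)).1 (ψ (i + 1)).2 (ψ i).2 :=
      fun i hi => (hψ i).resolve_left hi
    -- `ε` is the direction of a step and `c` its signed crossing of the seam: `∑ ε = (n + 2) * ∑
    -- c`, and `∑ c` modulo `2` is the holonomy.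
    let ε : Fin (n + 2) → ℤ := fun i => if Up i then 1 else -1
    let c : Fin (n + 2) → ℤ := fun i =>
      if Up i then (if (ψ i).1 = Fin.last (n + 1) then 1 else 0)
      else -(if (ψ (i + 1)).1 = Fin.last (n + 1) then 1 else 0)
    have hε : ∀ i, ((ψ (i + 1)).1.val : ℤ) = (ψ i).1.val + ε i - (n + 2) * c i := fun i => by
      by_cases hi : Up i
      · simp only [ε, c, if_pos hi]
        rw [hi.1, val_add_one_eq]
      · simp only [ε, c, if_neg hi]
        have := val_add_one_eq (ψ (i + 1)).1
        rw [← (hdown i hi).1] at this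
        rw [this]
        ring
    have hc : ∀ i, ((c i : ℤ) : ZMod 2) = twist (ψ i) (ψ (i + 1)) := fun i => by
      by_cases hi : Up i
      · rw [twist_up hn hi.1]
        simp only [c, if_pos hi]
        split_ifs <;> simp
      · rw [twist_symm, twist_up hn (hdown i hi).1]
        simp only [c, if_neg hi]
        split_ifs <;> simp
    have hsum : ((n : ℤ) + 2) * ∑ i, c i = ∑ i, ε i := by
      have h1 := sum_shift fun i => ((ψ i).1.val : ℤ)
      simp only [hε] at h1
      rw [Finset.sum_sub_distrib, Finset.sum_add_distrib, ← Finset.mul_sum] at h1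
      linarith
    have hcne : ∑ i, c i ≠ 0 := fun h => h0 (by
      rw [holonomy, ← Finset.sum_congr rfl fun i _ => hc i, ← Int.cast_sum, h, Int.cast_zero])
    have hε1 : ∀ i, ε i ≤ 1 ∧ -1 ≤ ε i := fun i => by
      simp only [ε]; split_ifs <;> simp
    -- Now `|∑ ε|` is at least the number of its terms, each of which is `±1`; so all terms are
    -- equal.
    rcases lt_or_gt_of_ne hcne with h | h
    · have h1 : ∑ i, ε i ≤ ∑ _i : Fin (n + 2), (-1 : ℤ) := by
        rw [← hsum]; simp; nlinarith
      have h2 := (Finset.sum_eq_sum_iff_of_le fun i _ => (hε1 i).2).1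
        (le_antisymm (Finset.sum_le_sum fun i _ => (hε1 i).2) h1)
      have hd : ∀ i, (ψ i).1 = (ψ (i + 1)).1 + 1 ∧ R (ψ (i + 1)).1 (ψ (i + 1)).2 (ψ i).2 :=
        fun i => hdown i fun hi => by
          have := h2 i (Finset.mem_univ _)
          simp only [ε, if_pos hi] at this
          omega
      have hpos : ∀ i, (ψ i).1 = (ψ 0).1 - i := fun i => by
        induction i using Fin.induction with
        | zero => simp
        | succ i ih =>
          have := (hd i.castSucc).1
          rw [ih, Fin.coeSucc_eq_succ] at this
          rw [← Fin.coeSucc_eq_succ, sub_add_eq_sub_sub, this, Fin.coeSucc_eq_succ]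
          abel
      -- The walk descends, being in layer `(ψ 0).1 - i` at time `i`; it is read backwards.
      refine ⟨fun j => (ψ ((ψ 0).1 - j)).2, fun j => ?_⟩
      have := (hd ((ψ 0).1 - (j + 1))).2
      rw [hpos ((ψ 0).1 - (j + 1) + 1), show (ψ 0).1 - (j + 1) + 1 = (ψ 0).1 - j by abel] at this
      rwa [sub_sub_cancel] at this
    · have h1 : ∑ _i : Fin (n + 2), (1 : ℤ) ≤ ∑ i, ε i := by
        rw [← hsum]; simp; nlinarith
      have h2 := (Finset.sum_eq_sum_iff_of_le fun i _ => (hε1 i).1).1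
        (le_antisymm (Finset.sum_le_sum fun i _ => (hε1 i).1) h1)
      have hu : ∀ i, Up i := fun i => by
        by_contra hi
        have := h2 i (Finset.mem_univ _)
        simp only [ε, if_neg hi] at this
        omega
      have hpos : ∀ i, (ψ i).1 = (ψ 0).1 + i := fun i => by
        induction i using Fin.induction with
        | zero => simp
        | succ i ih =>
          have := (hu i.castSucc).1
          rw [ih, Fin.coeSucc_eq_succ] at this
          rw [← Fin.coeSucc_eq_succ, ← add_assoc, ← this, Fin.coeSucc_eq_succ]
      refine ⟨fun j => (ψ (j - (ψ 0).1)).2, fun j => ?_⟩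
      have := (hu (j - (ψ 0).1)).2
      rwa [hpos (j - (ψ 0).1), add_sub_cancel, sub_add_eq_add_sub] at this
  · rintro ⟨p, hp⟩
    refine ⟨fun i => (i, p i), fun i => Or.inl ⟨rfl, hp i⟩, ?_⟩
    have : holonomy twist (fun i => (i, p i)) = 1 := by
      rw [holonomy, Finset.sum_congr rfl fun i _ => twist_up hn rfl]
      simp
    rw [this]
    exact one_ne_zero

/-! ### Cyclic chains of darts and triangles -/

/-- Sequences on `ℕ` with a separate closing condition allow treating the layers one by one without
modular arithmetic. -/
theorem exists_cyclic_iff {P : Type*} {n : ℕ} (S : ℕ → P → P → Prop) :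
    (∃ p : Fin (n + 2) → P, ∀ j : Fin (n + 2), S j (p j) (p (j + 1))) ↔
      ∃ q : ℕ → P, q (n + 2) = q 0 ∧ ∀ i < n + 2, S i (q i) (q (i + 1)) := by
  constructor
  · rintro ⟨p, hp⟩
    refine ⟨fun i => p (Fin.ofNat (n + 2) i), congrArg p (Fin.ext (by simp)), fun i hi => ?_⟩
    have := hp (Fin.ofNat (n + 2) i)
    have h1 : (Fin.ofNat (n + 2) i).val = i := Nat.mod_eq_of_lt hi
    have h2 : Fin.ofNat (n + 2) i + 1 = Fin.ofNat (n + 2) (i + 1) := by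
      ext; simp [Fin.val_add]
    rwa [h1, h2] at this
  · rintro ⟨q, hq, h⟩
    refine ⟨fun j => q j, fun j => ?_⟩
    have := h j j.2
    cases j using Fin.lastCases with
    | last =>
      rw [Fin.val_last, hq] at this
      rw [Fin.last_add_one]
      exact this
    | cast j =>
      rw [Fin.coeSucc_eq_succ]
      exact this

/-- The layers that consist of darts; the others consist of vertices. -/
def DartLayer (k j : ℕ) : Prop := j % 2 = 1 ∧ j < 6 ∧ j < 2 * (k - 3)

instance (k j : ℕ) : Decidable (DartLayer k j) := inferInstanceAs (Decidable (_ ∧ _ ∧ _))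

/-- The kind of the lower ends of the edges between layers `j` and `j + 1`. -/
def lower (k j : ℕ) : Kind := if DartLayer k j ∨ 6 ≤ j then .self else .tail

/-- The kind of the upper ends of the edges between layers `j` and `j + 1`. -/
def upper (k j : ℕ) : Kind := if DartLayer k (j + 1) ∨ 6 ≤ j then .self else .head

theorem lower_of_le {k j : ℕ} (h : 6 ≤ j) : lower k j = .self := if_pos (Or.inr h)

theorem upper_of_le {k j : ℕ} (h : 6 ≤ j) : upper k j = .self := if_pos (Or.inr h)

/-- For `k ≥ 6`, the kinds in the first six layers. -/
theorem kinds_of_six_le {k : ℕ} (hk : 6 ≤ k) :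
    (lower k 0 = .tail ∧ upper k 0 = .self ∧ lower k 1 = .self ∧ upper k 1 = .head) ∧
    (lower k 2 = .tail ∧ upper k 2 = .self ∧ lower k 3 = .self ∧ upper k 3 = .head) ∧
    (lower k 4 = .tail ∧ upper k 4 = .self ∧ lower k 5 = .self ∧ upper k 5 = .head) := by
  have h1 : 1 < 2 * (k - 3) := by omega
  have h3 : 3 < 2 * (k - 3) := by omega
  have h5 : 5 < 2 * (k - 3) := by omega
  simp [lower, upper, DartLayer, h1, h3, h5]

/-- The adjacency between consecutive layers, on the numbers given by `val`. -/
def ChainRel {E P : Type*} (val : Kind → E → P) (k j : ℕ) (x y : P) : Prop :=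
  ∃ e, x = val (lower k j) e ∧ y = val (upper k j) e

/-- As `self` is injective, the two edges at a dart belong to the same dart, so passing a dart layer
is following an edge of the graph. `hrep` lets the number of a vertex pass through the identity
edges of the copies of layer `0`. -/
theorem exists_chain_iff {E P : Type*} {val : Kind → E → P}
    (hself : Function.Injective (val .self)) (hrep : ∀ a, ∃ e, val .self e = val .tail a)
    {n : ℕ} (hn : 2 ≤ n) :
    (∃ p : Fin (n + 2) → P, ∀ j : Fin (n + 2), ChainRel val (n + 2) j (p j) (p (j + 1))) ↔
      ∃ a b c, val .head a = val .tail b ∧ val .head b = val .tail c ∧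
        val .head c = val .tail a := by
  rw [exists_cyclic_iff (ChainRel val (n + 2))]
  have dart : ∀ {x y z : P}, (∃ e, x = val .tail e ∧ y = val .self e) →
      (∃ e, y = val .self e ∧ z = val .head e) → ∃ e, x = val .tail e ∧ z = val .head e := by
    rintro x y z ⟨e, hx, hy⟩ ⟨e', hy', hz⟩
    obtain rfl : e = e' := hself (hy.symm.trans hy')
    exact ⟨e, hx, hz⟩
  have tri : ∀ {x y z : P}, (∃ e, x = val .tail e ∧ y = val .head e) →
      (∃ e, y = val .tail e ∧ z = val .head e) → (∃ e, z = val .tail e ∧ x = val .head e) →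
      ∃ a b c, val .head a = val .tail b ∧ val .head b = val .tail c ∧
        val .head c = val .tail a := by
    rintro x y z ⟨a, ha, ha'⟩ ⟨b, hb, hb'⟩ ⟨c, hc, hc'⟩
    exact ⟨a, b, c, ha'.symm.trans hb, hb'.symm.trans hc, hc'.symm.trans ha⟩
  obtain rfl | rfl | hn : n = 2 ∨ n = 3 ∨ 4 ≤ n := by omega
  · constructor
    · rintro ⟨q, hq, h⟩
      have h3 := h 3 (by omega)
      rw [hq] at h3
      exact tri (dart (h 0 (by omega)) (h 1 (by omega))) (h 2 (by omega)) h3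
    · rintro ⟨a, b, c, hab, hbc, hca⟩
      refine ⟨fun i => match i with
        | 1 => val .self a
        | 2 => val .tail b
        | 3 => val .tail c
        | _ => val .tail a, rfl, fun i hi => ?_⟩
      interval_cases i
      · exact ⟨a, rfl, rfl⟩
      · exact ⟨a, rfl, hab.symm⟩
      · exact ⟨b, rfl, hbc.symm⟩
      · exact ⟨c, rfl, hca.symm⟩
  · constructor
    · rintro ⟨q, hq, h⟩
      have h4 := h 4 (by omega)
      rw [hq] at h4
      exact tri (dart (h 0 (by omega)) (h 1 (by omega))) (dart (h 2 (by omega)) (h 3 (by omega))) h4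
    · rintro ⟨a, b, c, hab, hbc, hca⟩
      refine ⟨fun i => match i with
        | 1 => val .self a
        | 2 => val .tail b
        | 3 => val .self b
        | 4 => val .tail c
        | _ => val .tail a, rfl, fun i hi => ?_⟩
      interval_cases i
      · exact ⟨a, rfl, rfl⟩
      · exact ⟨a, rfl, hab.symm⟩
      · exact ⟨b, rfl, rfl⟩
      · exact ⟨b, rfl, hbc.symm⟩
      · exact ⟨c, rfl, hca.symm⟩
  · obtain ⟨⟨k0, k0', k1, k1'⟩, ⟨k2, k2', k3, k3'⟩, k4, k4', k5, k5'⟩ :=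
      kinds_of_six_le (k := n + 2) (by omega)
    constructor
    · rintro ⟨q, hq, h⟩
      have h0 := h 0 (by omega)
      have h1 := h 1 (by omega)
      have h2 := h 2 (by omega)
      have h3 := h 3 (by omega)
      have h4 := h 4 (by omega)
      have h5 := h 5 (by omega)
      rw [ChainRel] at h0 h1 h2 h3 h4 h5
      rw [k0, k0'] at h0
      rw [k1, k1'] at h1
      rw [k2, k2'] at h2
      rw [k3, k3'] at h3
      rw [k4, k4'] at h4
      rw [k5, k5'] at h5
      -- From layer `6` on, and into layer `0`, both ends of an edge are `self`: such edges preserve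
      -- the number.
      have hconst : ∀ d, 6 + d ≤ n + 2 → q (6 + d) = q 6 := fun d => by
        induction d with
        | zero => exact fun _ => rfl
        | succ d ih =>
          intro hd
          obtain ⟨e, he, he'⟩ := h (6 + d) (by omega)
          rw [lower_of_le (by omega)] at he
          rw [upper_of_le (by omega)] at he'
          rw [← ih (by omega), he, ← he']
          rfl
      have h6 : q 6 = q 0 := by
        rw [← hq, ← hconst (n + 2 - 6) (by omega)]
        congr 1
        omega
      have h45 := dart h4 h5
      rw [h6] at h45
      exact tri (dart h0 h1) (dart h2 h3) h45
    · rintro ⟨a, b, c, hab, hbc, hca⟩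
      obtain ⟨d, hd⟩ := hrep a
      refine ⟨fun i => match i with
        | 1 => val .self a
        | 2 => val .tail b
        | 3 => val .self b
        | 4 => val .tail c
        | 5 => val .self c
        | _ => val .tail a, ?_, fun i hi => ?_⟩
      · obtain ⟨n, rfl⟩ := Nat.exists_eq_add_of_le' hn
        rfl
      · rcases lt_or_ge i 6 with h6 | h6
        · rw [ChainRel]
          interval_cases i
          · rw [k0, k0']; exact ⟨a, rfl, rfl⟩
          · rw [k1, k1']; exact ⟨a, rfl, hab.symm⟩
          · rw [k2, k2']; exact ⟨b, rfl, rfl⟩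
          · rw [k3, k3']; exact ⟨b, rfl, hbc.symm⟩
          · rw [k4, k4']; exact ⟨c, rfl, rfl⟩
          · rw [k5, k5']; exact ⟨c, rfl, hca.symm⟩
        · obtain ⟨i, rfl⟩ := Nat.exists_eq_add_of_le' h6
          rw [ChainRel, lower_of_le h6, upper_of_le h6]
          exact ⟨d, hd.symm, hd.symm⟩

/-! ### Degeneracy -/

/-- Sort by rank. The order within a rank is arbitrary, so neighbours of equal rank are counted as
later. -/
theorem isDegenerate_of_rank {n κ : ℕ} {G : SimpleGraph (Fin n)} (rank : Fin n → ℕ)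
    (h : ∀ x, {y | rank x ≤ rank y ∧ G.Adj x y}.ncard ≤ κ) : IsDegenerate κ G := by
  refine ⟨Tuple.sort rank, fun i => le_trans ?_ (h (Tuple.sort rank i))⟩
  rw [← Set.ncard_image_of_injective _ (Tuple.sort rank).injective]
  refine Set.ncard_le_ncard ?_ (Set.toFinite _)
  rintro _ ⟨j, ⟨hij, hadj⟩, rfl⟩
  exact ⟨Tuple.monotone_sort rank hij.le, hadj⟩

/-- Darts come first. At most one later neighbour lies above `x` and at most one below: if the end
at `x` is `self`, it determines the dart and hence the edge; otherwise the neighbour is a dart and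
comes earlier. -/
theorem ncard_layered_le {E P : Type*} [Finite P] {val : Kind → E → P}
    (hself : Function.Injective (val .self)) {n : ℕ} (hn : 4 ≤ n)
    (χ : Fin (n + 2) × P → Fin (n + 2) × P → ZMod 2) (hχ : ∀ x y, χ x y = χ y x)
    (x : ZMod 2 × Fin (n + 2) × P) :
    {y : ZMod 2 × Fin (n + 2) × P |
      (if DartLayer (n + 2) x.2.1 then 0 else 1) ≤ (if DartLayer (n + 2) y.2.1 then 0 else 1) ∧
      (twoLift (layered fun j => ChainRel val (n + 2) j) χ hχ).Adj x y}.ncard ≤ 2 := by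
  set U := {y : ZMod 2 × Fin (n + 2) × P |
    (if DartLayer (n + 2) x.2.1 then 0 else 1) ≤ (if DartLayer (n + 2) y.2.1 then 0 else 1) ∧
    y.1 = x.1 + χ x.2 y.2 ∧ y.2.1 = x.2.1 + 1 ∧ ChainRel val (n + 2) x.2.1 x.2.2 y.2.2} with hU
  set D := {y : ZMod 2 × Fin (n + 2) × P |
    (if DartLayer (n + 2) x.2.1 then 0 else 1) ≤ (if DartLayer (n + 2) y.2.1 then 0 else 1) ∧
    y.1 = x.1 + χ x.2 y.2 ∧ x.2.1 = y.2.1 + 1 ∧ ChainRel val (n + 2) y.2.1 y.2.2 x.2.2} with hD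
  have hsub : {y : ZMod 2 × Fin (n + 2) × P |
      (if DartLayer (n + 2) x.2.1 then 0 else 1) ≤ (if DartLayer (n + 2) y.2.1 then 0 else 1) ∧
      (twoLift (layered fun j => ChainRel val (n + 2) j) χ hχ).Adj x y} ⊆ U ∪ D := by
    rintro y ⟨h1, h2 | h2, h3⟩
    · exact Or.inl ⟨h1, h3, h2⟩
    · exact Or.inr ⟨h1, h3, h2⟩
  have hval : ∀ j : Fin (n + 2), (j + 1).val = j.val + 1 ∨ (j + 1).val = 0 ∧ j.val = n + 1 :=
    fun j => by
      cases j using Fin.lastCases with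
      | last => right; simp
      | cast j => left; rw [Fin.coeSucc_eq_succ]; simp
  have hdart : ∀ j, DartLayer (n + 2) j ↔ j = 1 ∨ j = 3 ∨ j = 5 := fun j => by
    unfold DartLayer; omega
  have hrank : ∀ {i j : ℕ}, DartLayer (n + 2) j →
      (if DartLayer (n + 2) i then 0 else 1) ≤ (if DartLayer (n + 2) j then 0 else 1) →
      DartLayer (n + 2) i := fun {i j} hj h => by
    rw [if_pos hj] at h
    by_contra hi
    rw [if_neg hi] at h
    omega
  -- If the lower end is not `self`, then `x` is in layer `0`, `2` or `4`, and the layer above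
  -- consists of darts.
  have hU1 : ∀ y ∈ U, lower (n + 2) x.2.1 = .self := fun y hy => by
    by_contra hl
    have h1 : ¬ (DartLayer (n + 2) x.2.1 ∨ 6 ≤ x.2.1.val) := fun h => hl (if_pos h)
    obtain ⟨hr, -, hj, e, hx, -⟩ := hy
    have hv := hval x.2.1
    rw [← hj] at hv
    by_cases hy : DartLayer (n + 2) y.2.1
    · exact h1 (Or.inl (hrank hy hr))
    · rw [hdart] at h1 hy
      omega
  have hD1 : ∀ y ∈ D, upper (n + 2) y.2.1 = .self := fun y hy => by
    by_contra hl
    have h1 : ¬ (DartLayer (n + 2) (y.2.1 + 1) ∨ 6 ≤ y.2.1.val) := fun h => hl (if_pos h)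
    obtain ⟨hr, -, hj, -⟩ := hy
    have hv := hval y.2.1
    rw [← hj] at hv
    by_cases hy : DartLayer (n + 2) y.2.1
    · have := hrank hy hr
      rw [hdart] at h1 hy this
      omega
    · rw [hdart] at h1 hy
      omega
  have hUc : U.ncard ≤ 1 := by
    refine (Set.ncard_le_one (Set.toFinite _)).2 fun y hy z hz => ?_
    have hl := hU1 y hy
    obtain ⟨-, hy1, hy2, e, he, he'⟩ := hy
    obtain ⟨-, hz1, hz2, f, hf, hf'⟩ := hz
    rw [hl] at he hf
    obtain rfl : e = f := hself (he.symm.trans hf)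
    have h2 : y.2 = z.2 := Prod.ext (hy2.trans hz2.symm) (he'.trans hf'.symm)
    exact Prod.ext (by rw [hy1, hz1, h2]) h2
  have hDc : D.ncard ≤ 1 := by
    refine (Set.ncard_le_one (Set.toFinite _)).2 fun y hy z hz => ?_
    have hl := hD1 y hy
    obtain ⟨-, hy1, hy2, e, he, he'⟩ := hy
    obtain ⟨-, hz1, hz2, f, hf, hf'⟩ := hz
    have hyz : y.2.1 = z.2.1 := add_right_cancel (hy2.symm.trans hz2)
    rw [hl] at he'
    rw [← hyz, hl] at hf'
    obtain rfl : e = f := hself (he'.symm.trans hf')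
    have h2 : y.2 = z.2 := Prod.ext hyz (by rw [he, hf, hyz])
    exact Prod.ext (by rw [hy1, hz1, h2]) h2
  exact (Set.ncard_le_ncard hsub (Set.toFinite _)).trans
    ((Set.ncard_union_le _ _).trans (by omega))

/-! ### Inputs given by indexed lists of edges -/

/-- A graph on a type `V` of `n` elements as an input, where the edges are given by an injective
family, in the order of a list of indices. -/
def GraphInput.ofFamily {V ι : Type*} {n : ℕ} (hn : 0 < n) (φ : V ≃ Fin n) (G : SimpleGraph V)
    (I : List ι) (src tgt : ι → V) (hI : I.Nodup)
    (hinj : ∀ i i', s(src i, tgt i) = s(src i', tgt i') → i = i')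
    (hadj : ∀ x y, G.Adj x y ↔ ∃ i ∈ I, s(src i, tgt i) = s(x, y)) : GraphInput where
  n := n
  pos := hn
  graph := G.comap φ.symm
  edges := I.map fun i => (φ (src i), φ (tgt i))
  nodup := by
    rw [List.map_map]
    refine hI.map fun i i' h => hinj i i' ?_
    have := congrArg (Sym2.map φ.symm) h
    simpa using this
  mem_iff := by
    refine Sym2.ind fun x y => ?_
    rw [mem_edgeSet, comap_adj, hadj, List.map_map, List.mem_map]
    refine exists_congr fun i => and_congr_right fun _ => ⟨fun h => ?_, fun h => ?_⟩
    · have := congrArg (Sym2.map φ.symm) h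
      simpa using this
    · have := congrArg (Sym2.map φ) h
      simpa using this

/-! ### Endpoints -/

theorem getD_flatMap_pair {α : Type*} (f g : α → ℕ) (l : List α) {i : ℕ} (hi : i < l.length) :
    (l.flatMap fun e => [f e, g e]).getD (2 * i) 0 = f l[i] ∧
      (l.flatMap fun e => [f e, g e]).getD (2 * i + 1) 0 = g l[i] := by
  induction l generalizing i with
  | nil => simp at hi
  | cons a l ih =>
    cases i with
    | zero => simp
    | succ i =>
      have := ih (i := i) (by simpa using hi)
      simpa [mul_add] using this

namespace GraphInput

variable (F : GraphInput)

theorem length_encode : F.encode.length = 2 * F.m + 2 := by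
  simp [encode, List.length_flatMap, m, mul_comm]

/-- The endpoint at position `p`. -/
def ends (p : ℕ) : ℕ := F.encode.getD (p + 2) 0

variable {F}

theorem ends_pair {i : ℕ} (hi : i < F.m) :
    F.ends (2 * i) = (F.edges[i]'hi).1.val ∧ F.ends (2 * i + 1) = (F.edges[i]'hi).2.val := by
  have := getD_flatMap_pair (fun e : Fin F.n × Fin F.n => e.1.val) (fun e => e.2.val) F.edges hi
  simpa [ends, encode] using this

theorem edge_adj {i : ℕ} (hi : i < F.m) :
    F.graph.Adj (F.edges[i]'hi).1 (F.edges[i]'hi).2 :=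
  (F.mem_iff _).1 (List.mem_map.2 ⟨_, List.getElem_mem hi, rfl⟩)

theorem eq_or_eq_of_lt {p : ℕ} (hp : p < 2 * F.m) : ∃ i, ∃ hi : i < F.m,
    (p = 2 * i ∧ F.ends p = (F.edges[i]'hi).1.val ∧ F.ends (p ^^^ 1) = (F.edges[i]'hi).2.val) ∨
    (p = 2 * i + 1 ∧ F.ends p = (F.edges[i]'hi).2.val ∧
      F.ends (p ^^^ 1) = (F.edges[i]'hi).1.val) := by
  have hi : p / 2 < F.m := by omega
  have h := ends_pair hi
  refine ⟨p / 2, hi, ?_⟩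
  rw [xor_one_eq]
  rcases Nat.mod_two_eq_zero_or_one p with h0 | h0
  · left
    rw [show p + 1 - 2 * (p % 2) = 2 * (p / 2) + 1 by omega]
    refine ⟨by omega, ?_, h.2⟩
    rw [← h.1]
    congr 1
    omega
  · right
    rw [show p + 1 - 2 * (p % 2) = 2 * (p / 2) by omega]
    refine ⟨by omega, ?_, h.1⟩
    rw [← h.2]
    congr 1
    omega

theorem ends_adj {p : ℕ} (hp : p < 2 * F.m) :
    ∃ u v : Fin F.n, F.ends p = u ∧ F.ends (p ^^^ 1) = v ∧ F.graph.Adj u v := by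
  obtain ⟨i, hi, ⟨-, h1, h2⟩ | ⟨-, h1, h2⟩⟩ := eq_or_eq_of_lt hp
  · exact ⟨_, _, h1, h2, edge_adj hi⟩
  · exact ⟨_, _, h1, h2, (edge_adj hi).symm⟩

theorem ends_lt {p : ℕ} (hp : p < 2 * F.m) : F.ends p < F.n := by
  obtain ⟨u, v, h, -⟩ := ends_adj hp
  rw [h]
  exact u.2

theorem exists_dart {u v : Fin F.n} (h : F.graph.Adj u v) :
    ∃ p < 2 * F.m, F.ends p = u ∧ F.ends (p ^^^ 1) = v := by
  obtain ⟨e, he, huv⟩ := List.mem_map.1 ((F.mem_iff s(u, v)).2 h)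
  obtain ⟨i, hi, rfl⟩ := List.getElem_of_mem he
  have h' := ends_pair (F := F) hi
  have hi' : i < F.m := hi
  have e1 : (2 * i) ^^^ 1 = 2 * i + 1 := by rw [xor_one_eq]; omega
  have e2 : (2 * i + 1) ^^^ 1 = 2 * i := by rw [xor_one_eq]; omega
  rcases Sym2.eq_iff.1 huv with ⟨h1, h2⟩ | ⟨h1, h2⟩
  · exact ⟨2 * i, by omega, by rw [h'.1, h1], by rw [e1, h'.2, h2]⟩
  · exact ⟨2 * i + 1, by omega, by rw [h'.2, h2], by rw [e2, h'.1, h1]⟩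

theorem edges_inj {i j : ℕ} (hi : i < F.m) (hj : j < F.m)
    (h : s((F.edges[i]'hi).1, (F.edges[i]'hi).2) = s((F.edges[j]'hj).1, (F.edges[j]'hj).2)) :
    i = j := by
  refine (List.Nodup.getElem_inj_iff F.nodup (hi := by rw [List.length_map]; exact hi)
    (hj := by rw [List.length_map]; exact hj)).1 ?_
  rw [List.getElem_map, List.getElem_map]
  exact h

/-- Each edge is listed once, so equal ends mean the same edge; opposite orientations of it would
make a loop. -/
theorem dart_inj {p q : ℕ} (hp : p < 2 * F.m) (hq : q < 2 * F.m) (h : F.ends p = F.ends q)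
    (h' : F.ends (p ^^^ 1) = F.ends (q ^^^ 1)) : p = q := by
  obtain ⟨i, hi, ⟨pi, h1, h2⟩ | ⟨pi, h1, h2⟩⟩ := eq_or_eq_of_lt hp <;>
  obtain ⟨j, hj, ⟨qj, h3, h4⟩ | ⟨qj, h3, h4⟩⟩ := eq_or_eq_of_lt hq <;>
  rw [h1, h3] at h <;> rw [h2, h4] at h' <;> have e1 := Fin.ext h <;> have e2 := Fin.ext h'
  · obtain rfl := edges_inj hi hj (by rw [e1, e2])
    omega
  · obtain rfl := edges_inj hi hj (by rw [e1, e2, Sym2.eq_swap])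
    exact absurd e1 (edge_adj hi).ne
  · obtain rfl := edges_inj hi hj (by rw [e1, e2, Sym2.eq_swap])
    exact absurd e2 (edge_adj hi).ne
  · obtain rfl := edges_inj hi hj (by rw [e1, e2])
    omega

theorem m_le : F.m ≤ F.n * F.n := by
  have h : F.edges.Nodup := List.Nodup.of_map _ F.nodup
  simpa [m] using h.length_le_card

variable (F)

/-- The numbers attached to the darts. -/
def num (κ : Kind) (e : Fin (2 * F.m)) : Fin (2 * F.m + 1) :=
  ⟨κ.val F.ends F.m e, κ.val_lt _ e.2⟩

variable {F}

theorem num_self_injective : Function.Injective (F.num .self) := fun _ _ h =>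
  Fin.ext (congrArg Fin.val h :)

/-- A representative is a position in the list, hence again the number of a dart. The existence of
`a` makes the list nonempty, so even the default `0` is a valid position. -/
theorem exists_num_self (a : Fin (2 * F.m)) : ∃ e, F.num .self e = F.num .tail a := by
  have hlt : ∀ t v, 0 < t → lastIdx F.ends t v < t := fun t v ht => by
    obtain ⟨t, rfl⟩ := Nat.exists_eq_add_of_le' ht
    rw [lastIdx]
    split_ifs
    · omega
    · exact Nat.lt_succ_of_le (lastIdx_le _ _ _)
  exact ⟨⟨lastIdx F.ends (2 * F.m) (F.ends a), hlt _ _ (by have := a.2; omega)⟩, rfl⟩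

theorem lastIdx_eq_iff {p q : ℕ} (hp : p < 2 * F.m) (hq : q < 2 * F.m) :
    lastIdx F.ends (2 * F.m) (F.ends p) = lastIdx F.ends (2 * F.m) (F.ends q) ↔
      F.ends p = F.ends q :=
  ⟨fun h => by rw [← apply_lastIdx F.ends hp, h, apply_lastIdx F.ends hq], fun h => by rw [h]⟩

theorem num_head_eq_tail {a b : Fin (2 * F.m)} :
    F.num .head a = F.num .tail b ↔ F.ends (a ^^^ 1) = F.ends b := by
  rw [Fin.ext_iff, ← lastIdx_eq_iff (xor_one_lt a.2) b.2]
  rfl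

theorem exists_triangle_iff :
    (∃ a b c, F.num .head a = F.num .tail b ∧ F.num .head b = F.num .tail c ∧
      F.num .head c = F.num .tail a) ↔ ¬ F.graph.CliqueFree 3 := by
  simp only [num_head_eq_tail]
  constructor
  · rintro ⟨a, b, c, hab, hbc, hca⟩ h
    obtain ⟨x, y, hx, hy, hxy⟩ := ends_adj a.2
    obtain ⟨y', z, hy', hz, hyz⟩ := ends_adj b.2
    obtain ⟨z', x', hz', hx', hzx⟩ := ends_adj c.2
    obtain rfl : y = y' := Fin.ext (hy.symm.trans (hab.trans hy'))
    obtain rfl : z = z' := Fin.ext (hz.symm.trans (hbc.trans hz'))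
    obtain rfl : x' = x := Fin.ext (hx'.symm.trans (hca.trans hx))
    exact h {x', y, z} (is3Clique_triple_iff.2 ⟨hxy, hzx.symm, hyz⟩)
  · intro h
    simp only [CliqueFree, not_forall, not_not] at h
    obtain ⟨t, ht⟩ := h
    obtain ⟨x, y, z, hxy, hxz, hyz, -⟩ := is3Clique_iff.1 ht
    obtain ⟨a, ha, ha1, ha2⟩ := exists_dart hxy
    obtain ⟨b, hb, hb1, hb2⟩ := exists_dart hyz
    obtain ⟨c, hc, hc1, hc2⟩ := exists_dart hxz.symm
    exact ⟨⟨a, ha⟩, ⟨b, hb⟩, ⟨c, hc⟩, ha2.trans hb1.symm, hb2.trans hc1.symm, hc2.trans ha1.symm⟩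

/-- Distinct darts give distinct edges between two layers, so the output has no repeated edge. If
neither end is `self`, the ends are the two representatives, and `F` is simple. -/
theorem num_inj_of_kinds {k j : ℕ} {e e' : Fin (2 * F.m)}
    (h : F.num (lower k j) e = F.num (lower k j) e')
    (h' : F.num (upper k j) e = F.num (upper k j) e') : e = e' := by
  unfold lower at h
  unfold upper at h'
  split_ifs at h
  · exact num_self_injective h
  · split_ifs at h'
    · exact num_self_injective h'
    · exact Fin.ext (dart_inj e.2 e'.2 ((lastIdx_eq_iff e.2 e'.2).1 (congrArg Fin.val h :))
        ((lastIdx_eq_iff (xor_one_lt e.2) (xor_one_lt e'.2)).1 (congrArg Fin.val h' :)))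

/-! ### The two graphs -/

variable (F)

/-- The base graph of the two lifts. -/
def base (n : ℕ) : SimpleGraph (Fin (n + 2) × Fin (2 * F.m + 1)) :=
  layered fun j => ChainRel F.num (n + 2) j

end GraphInput

/-- The number of a layer in the lift. -/
def layerIdx {n : ℕ} (s : ZMod 2) (j : Fin (n + 2)) : Fin (2 * (n + 2)) :=
  finProdFinEquiv ((s : Fin 2), j)

/-- The numbering of the vertices of the lift. -/
def vertexEquiv (n N : ℕ) : ZMod 2 × Fin (n + 2) × Fin N ≃ Fin (2 * (n + 2) * N) :=
  (Equiv.prodAssoc (Fin 2) (Fin (n + 2)) (Fin N)).symm.trans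
    ((finProdFinEquiv.prodCongr (Equiv.refl _)).trans finProdFinEquiv)

theorem vertexEquiv_val {n N : ℕ} (s : ZMod 2) (j : Fin (n + 2)) (p : Fin N) :
    (vertexEquiv n N (s, j, p)).val = (layerIdx s j).val * N + p.val := by
  have : (vertexEquiv n N (s, j, p)).val = p.val + N * (layerIdx s j).val := rfl
  rw [this]
  ring

/-- The layers of the lift. -/
def layers (n : ℕ) : List (ZMod 2 × Fin (n + 2)) :=
  (List.finRange 2 : List (Fin 2)) ×ˢ List.finRange (n + 2)

theorem nodup_layers (n : ℕ) : (layers n).Nodup :=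
  (List.nodup_finRange 2).product (List.nodup_finRange (n + 2))

theorem mem_layers {n : ℕ} (x : ZMod 2 × Fin (n + 2)) : x ∈ layers n :=
  List.mem_product.2 ⟨List.mem_finRange (n := 2) x.1, List.mem_finRange x.2⟩

/-- The items that the reduction outputs for each dart; the edges above layer `j` are twisted
by `τ j`. -/
def liftItems (n : ℕ) (τ : Fin (n + 2) → ZMod 2) : List (ℕ × Kind) :=
  (layers n).flatMap fun x =>
    [((layerIdx x.1 x.2).val, lower (n + 2) x.2),
      ((layerIdx (x.1 + τ x.2) (x.2 + 1)).val, upper (n + 2) x.2)]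

theorem length_layers (n : ℕ) : (layers n).length = 2 * (n + 2) :=
  (List.length_product _ _).trans (by simp)

theorem length_liftItems (n : ℕ) (τ : Fin (n + 2) → ZMod 2) :
    (liftItems n τ).length = 4 * (n + 2) := by
  simp [liftItems, List.length_flatMap, length_layers]
  ring

theorem lt_of_mem_liftItems {n : ℕ} {τ : Fin (n + 2) → ZMod 2} {it : ℕ × Kind}
    (h : it ∈ liftItems n τ) : it.1 < 2 * (n + 2) := by
  simp only [liftItems, List.mem_flatMap, List.mem_cons, List.not_mem_nil, or_false] at h
  obtain ⟨x, -, rfl | rfl⟩ := h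
  · exact (layerIdx _ _).2
  · exact (layerIdx _ _).2

namespace GraphInput

variable (F : GraphInput)

/-- The lift of the base graph, as an input. -/
def lift (n : ℕ) (hn : 1 ≤ n) (τ : Fin (n + 2) → ZMod 2)
    (χ : Fin (n + 2) × Fin (2 * F.m + 1) → Fin (n + 2) × Fin (2 * F.m + 1) → ZMod 2)
    (hχ : ∀ x y, χ x y = χ y x) (hτ : ∀ x y, y.1 = x.1 + 1 → χ x y = τ x.1) : GraphInput :=
  GraphInput.ofFamily (n := 2 * (n + 2) * (2 * F.m + 1)) (by positivity)
    (vertexEquiv n (2 * F.m + 1)) (twoLift (F.base n) χ hχ)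
    (List.finRange (2 * F.m) ×ˢ layers n)
    (fun i => (i.2.1, i.2.2, F.num (lower (n + 2) i.2.2) i.1))
    (fun i => (i.2.1 + τ i.2.2, i.2.2 + 1, F.num (upper (n + 2) i.2.2) i.1))
    ((List.nodup_finRange _).product (nodup_layers n))
    (by
      rintro ⟨e, s, j⟩ ⟨e', s', j'⟩ h
      simp only [Sym2.eq_iff, Prod.mk.injEq] at h
      rcases h with ⟨⟨rfl, rfl, h⟩, -, -, h'⟩ | ⟨⟨-, h, -⟩, -, h', -⟩
      · rw [num_inj_of_kinds h h']
      -- Equality in opposite orientation would require a cycle of at most two layers.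
      · have h2 : j' + 1 + 1 = j' := by rw [← h, h']
        rw [add_assoc, add_eq_left] at h2
        have h3 := congrArg Fin.val h2
        rw [Fin.val_add, Fin.val_one, Fin.val_zero, Nat.mod_eq_of_lt (by omega)] at h3
        omega)
    (by
      have hup : ∀ x y : ZMod 2 × Fin (n + 2) × Fin (2 * F.m + 1),
          (y.2.1 = x.2.1 + 1 ∧ ChainRel F.num (n + 2) x.2.1 x.2.2 y.2.2) ∧ y.1 = x.1 + χ x.2 y.2 ↔
          ∃ i : Fin (2 * F.m) × ZMod 2 × Fin (n + 2),
            (i.2.1, i.2.2, F.num (lower (n + 2) i.2.2) i.1) = x ∧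
            (i.2.1 + τ i.2.2, i.2.2 + 1, F.num (upper (n + 2) i.2.2) i.1) = y := by
        rintro ⟨s, j, p⟩ ⟨s', j', p'⟩
        constructor
        · rintro ⟨⟨h1, e, h2, h3⟩, h4⟩
          rw [hτ _ _ h1] at h4
          exact ⟨(e, s, j), Prod.ext rfl (Prod.ext rfl h2.symm),
            Prod.ext h4.symm (Prod.ext h1.symm h3.symm)⟩
        · rintro ⟨⟨e, t, i⟩, h1, h2⟩
          simp only [Prod.mk.injEq] at h1 h2
          obtain ⟨rfl, rfl, rfl⟩ := h1
          obtain ⟨rfl, rfl, rfl⟩ := h2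
          exact ⟨⟨rfl, e, rfl, rfl⟩, by rw [hτ _ _ rfl]⟩
      intro x y
      have hsw : ((F.base n).Adj x.2 y.2 ∧ y.1 = x.1 + χ x.2 y.2) ↔
          ((y.2.1 = x.2.1 + 1 ∧ ChainRel F.num (n + 2) x.2.1 x.2.2 y.2.2) ∧
            y.1 = x.1 + χ x.2 y.2) ∨
          ((x.2.1 = y.2.1 + 1 ∧ ChainRel F.num (n + 2) y.2.1 y.2.2 x.2.2) ∧
            x.1 = y.1 + χ y.2 x.2) := by
        have : y.1 = x.1 + χ x.2 y.2 ↔ x.1 = y.1 + χ y.2 x.2 := by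
          rw [hχ y.2]
          constructor <;> intro h <;>
            rw [h, add_assoc, CharTwo.add_self_eq_zero, add_zero]
        rw [← this]
        exact or_and_right
      refine hsw.trans ?_
      rw [hup, hup, ← exists_or]
      refine exists_congr fun i => ?_
      have hi : i ∈ (List.finRange (2 * F.m) ×ˢ layers n) :=
        List.mem_product.2 ⟨List.mem_finRange _, mem_layers _⟩
      rw [Sym2.eq_iff]
      constructor
      · rintro (h | h)
        · exact ⟨hi, Or.inl h⟩
        · exact ⟨hi, Or.inr ⟨h.1, h.2⟩⟩
      · rintro ⟨-, h | h⟩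
        · exact Or.inl h
        · exact Or.inr ⟨h.1, h.2⟩)

variable {F} {n : ℕ} {hn : 1 ≤ n} {τ : Fin (n + 2) → ZMod 2}
    {χ : Fin (n + 2) × Fin (2 * F.m + 1) → Fin (n + 2) × Fin (2 * F.m + 1) → ZMod 2}
    {hχ : ∀ x y, χ x y = χ y x} {hτ : ∀ x y, y.1 = x.1 + 1 → χ x y = τ x.1}

theorem lift_n : (F.lift n hn τ χ hχ hτ).n = 2 * (n + 2) * (2 * F.m + 1) := rfl

theorem lift_m : (F.lift n hn τ χ hχ hτ).m = 2 * (n + 2) * (2 * F.m) := by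
  have : (F.lift n hn τ χ hχ hτ).m = (List.finRange (2 * F.m) ×ˢ layers n).length :=
    List.length_map _
  rw [this, List.length_product, length_layers, List.length_finRange, mul_comm]

theorem homCount_lift {U : Type*} (H : SimpleGraph U) :
    homCount H (F.lift n hn τ χ hχ hτ).graph = homCount H (twoLift (F.base n) χ hχ) :=
  homCount_congr H (SimpleGraph.Iso.comap (vertexEquiv n (2 * F.m + 1)).symm _)

/-- The edge list of `lift` runs through the darts and, for each dart, through the layers, exactly
as the program writes it. -/
theorem encode_lift : (F.lift n hn τ χ hχ hτ).encode
    = roundWords F.ends F.m (n + 2) (liftItems n τ) (2 * F.m) := by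
  have h : (F.lift n hn τ χ hχ hτ).edges.flatMap (fun e => [e.1.val, e.2.val])
      = (List.range (2 * F.m)).flatMap (itemWords F.ends F.m (liftItems n τ)) := by
    rw [← List.map_coe_finRange_eq_range, List.flatMap_map]
    simp only [lift, ofFamily, List.flatMap_map, SProd.sprod, List.product, List.flatMap_assoc]
    congr 1
    funext e
    simp only [itemWords, liftItems, List.map_flatMap, vertexEquiv_val]
    rfl
  rw [encode, h, lift_m, lift_n]
  rfl

theorem isDegenerate_lift (h : 4 ≤ n) : IsDegenerate 2 (F.lift n hn τ χ hχ hτ).graph := by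
  set φ := vertexEquiv n (2 * F.m + 1)
  refine isDegenerate_of_rank (n := 2 * (n + 2) * (2 * F.m + 1))
    (fun x => if DartLayer (n + 2) (φ.symm x).2.1 then 0 else 1) fun x => ?_
  refine le_trans (le_of_eq ?_) (ncard_layered_le num_self_injective h χ hχ (φ.symm x))
  rw [← Set.ncard_image_of_injective _ φ.symm.injective]
  congr 1
  ext y
  constructor
  · rintro ⟨z, hz, rfl⟩
    exact hz
  · intro hy
    refine ⟨φ y, ?_, φ.symm_apply_apply y⟩
    simp only [Set.mem_ofPred_eq, φ.symm_apply_apply]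
    refine ⟨hy.1, ?_⟩
    have := hy.2
    rw [← φ.symm_apply_apply y] at this
    exact this

end GraphInput

namespace GraphInput

variable (F : GraphInput) (n : ℕ) (hn : 1 ≤ n)

/-- Two disjoint copies of the base graph. -/
def untwisted : GraphInput :=
  F.lift n hn (fun _ => 0) (fun _ _ => 0) (fun _ _ => rfl) fun _ _ _ => rfl

/-- The connected two-fold lift of the base graph. -/
def twisted : GraphInput :=
  F.lift n hn (fun j => if j = Fin.last (n + 1) then 1 else 0) twist twist_symm
    fun _ _ h => twist_up hn h

variable {F n hn}

theorem homCount_eq_iff (hn' : 2 ≤ n) :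
    homCount (cycleGraph (n + 2)) (F.untwisted n hn).graph
        = homCount (cycleGraph (n + 2)) (F.twisted n hn).graph ↔ F.graph.CliqueFree 3 := by
  rw [untwisted, twisted, homCount_lift, homCount_lift, homCount_twoLift_eq_iff, ← not_iff_not,
    ← exists_triangle_iff, ← exists_chain_iff num_self_injective exists_num_self hn',
    ← exists_holonomy_ne_zero_iff hn fun j => ChainRel F.num (n + 2) j]
  push Not
  rfl

open Classical in
-- With truncated subtraction, `1 - (x ^^^ y)` is an equality test without branching.
theorem one_sub_xor_eq (hn' : 2 ≤ n) :
    1 - (homCount (cycleGraph (n + 2)) (F.untwisted n hn).graph ^^^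
      homCount (cycleGraph (n + 2)) (F.twisted n hn).graph) = triangleFreeAnswer F.graph := by
  rw [triangleFreeAnswer]
  split_ifs with h
  · rw [(homCount_eq_iff hn').2 h, Nat.xor_self]
  · rw [← homCount_eq_iff (hn := hn) hn', ← Nat.xor_eq_zero_iff] at h
    omega

theorem homCount_cycleGraph_le (G : GraphInput) (n : ℕ) :
    homCount (cycleGraph (n + 2)) G.graph ≤ G.n ^ (n + 2) := by
  rw [homCount_cycleGraph]
  refine (Set.ncard_le_ncard (Set.subset_univ _) (Set.toFinite _)).trans (le_of_eq ?_)
  simp [Set.ncard_univ]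

theorem two_mul_m_add_one_le (F : GraphInput) : 2 * F.m + 1 ≤ 3 * F.n ^ 2 := by
  have h1 := F.m_le
  have h2 := Nat.mul_le_mul F.pos F.pos
  rw [sq]
  omega

end GraphInput

/-! ### Word sizes -/

/-- Polynomially bounded numbers fit into `O(log N)` bits; the constant factor is absorbed crudely
by `K < 2 ^ K`. -/
theorem lt_two_pow_log {N x K e : ℕ} (h : x ≤ K * N ^ e) :
    x < 2 ^ ((K + e) * (Nat.log 2 N + 1)) := by
  have h1 : N ^ e ≤ 2 ^ (e * (Nat.log 2 N + 1)) := by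
    rw [mul_comm, pow_mul]
    exact Nat.pow_le_pow_left (Nat.lt_pow_succ_log_self one_lt_two N).le e
  have h2 : K < 2 ^ (K * (Nat.log 2 N + 1)) :=
    Nat.lt_two_pow_self.trans_le
      (Nat.pow_le_pow_right two_pos (Nat.le_mul_of_pos_right _ (by omega)))
  calc x ≤ K * N ^ e := h
    _ < 2 ^ (K * (Nat.log 2 N + 1)) * 2 ^ (e * (Nat.log 2 N + 1)) :=
      Nat.mul_lt_mul_of_lt_of_le h2 h1 (by positivity)
    _ = _ := by rw [← pow_add, add_mul]

theorem two_pow_le_of_le {a b l : ℕ} (h : a ≤ b) : 2 ^ (a * l) ≤ 2 ^ (b * l) :=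
  Nat.pow_le_pow_right two_pos (Nat.mul_le_mul_right _ h)

theorem two_pow_add_le {x y : ℕ} : 2 ^ x + 2 ^ y ≤ 2 ^ (x + y + 1) := by
  have hx := Nat.one_le_two_pow (n := x)
  have hy := Nat.one_le_two_pow (n := y)
  rw [pow_succ, pow_add]
  nlinarith

namespace GraphInput

/-- A constant for the word size of the reduction. -/
def wordConst (n : ℕ) : ℕ := 49 * (n + 3) + 2

theorem reduction_bound (F : GraphInput) (n : ℕ) :
    F.n + 16 * ((n + 2 + 1) * (2 * F.m + 1)) < 2 ^ (wordConst n * (Nat.log 2 F.n + 1)) := by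
  refine lt_two_pow_log ?_
  have h1 := F.two_mul_m_add_one_le
  have h2 : F.n ≤ F.n ^ 2 := Nat.le_self_pow two_ne_zero _
  nlinarith [Nat.mul_le_mul_left (n + 3) h1]

/-- A constant for the word size that the homomorphism counts need. -/
def countConst (n : ℕ) : ℕ := (6 * (n + 2)) ^ (n + 2) + 2 * (n + 2)

theorem lift_n_le (F : GraphInput) (n : ℕ) :
    2 * (n + 2) * (2 * F.m + 1) ≤ 6 * (n + 2) * F.n ^ 2 := by
  nlinarith [Nat.mul_le_mul_left (n + 2) F.two_mul_m_add_one_le]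

theorem count_bound (F G : GraphInput) (n : ℕ) (h : G.n = 2 * (n + 2) * (2 * F.m + 1)) :
    homCount (cycleGraph (n + 2)) G.graph < 2 ^ (countConst n * (Nat.log 2 F.n + 1)) := by
  refine lt_two_pow_log ((G.homCount_cycleGraph_le n).trans ?_)
  rw [h]
  calc _ ≤ (6 * (n + 2) * F.n ^ 2) ^ (n + 2) := Nat.pow_le_pow_left (F.lift_n_le n) _
    _ = _ := by rw [mul_pow, ← pow_mul]

end GraphInput

namespace WordRAM

theorem codeAt_self (P : Program) : CodeAt P 0 P := fun i _ => by rw [zero_add]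

theorem Ends.of_reaches {P : Program} {w q q' T : ℕ} {r m : ℕ → ℕ}
    {Q : (ℕ → ℕ) → (ℕ → ℕ) → Prop} {Q' : Config → Prop} {K : ℝ≥0∞}
    (h : Reaches P w q q' T r m Q) (h' : ∀ r' m', Q r' m' → Ends P w Q' K ⟨q', r', m'⟩) :
    Ends P w Q' (T + K) ⟨q, r, m⟩ := by
  obtain ⟨t, ht, r', m', hr, hQ⟩ := h
  exact (Ends.of_run hr (h' r' m' hQ)).mono (add_le_add (by exact_mod_cast ht) le_rfl)

/-- Zeros beyond the list are needed for the cells to look like the initial memory of a machine with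
input `l`. -/
theorem writeList_eq_getD {m : ℕ → ℕ} {o s : ℕ} (hs : 0 < s) (l : List ℕ) {x : ℕ}
    (hz : m (o + s * x) = 0) : writeList m o s l (o + s * x) = l.getD x 0 := by
  rcases lt_or_ge x l.length with hx | hx
  · rw [writeList_apply m o hs l hx, List.getD_eq_getElem _ _ hx]
  · rw [writeList_of_ne, hz, List.getD_eq_default _ _ hx]
    intro i hi h
    have : s * x = s * i := by omega
    rw [Nat.eq_of_mul_eq_mul_left hs this] at hx
    omega

/-! ### The reduction on an input graph -/

section

variable {F : GraphInput} {n : ℕ} {hn : 1 ≤ n}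

/-- The reduction with output stride `s`; the second output starts `c₁ * 2m + c₂` words after
the first one. -/
def liftReduction (n s c₁ c₂ : ℕ) : Program :=
  reduction (n + 2) s c₁ c₂ (liftItems n fun _ => 0)
    (liftItems n fun j => if j = Fin.last (n + 1) then 1 else 0)

theorem encode_getD_of_le {x : ℕ} (h : 2 * F.m + 2 ≤ x) : F.encode.getD x 0 = 0 :=
  List.getD_eq_default _ _ (by rw [F.length_encode]; exact h)

theorem reaches_liftReduction {P : Program} {w s c₁ c₂ : ℕ}
    (hc : CodeAt P 0 (liftReduction n s c₁ c₂)) (hs : s ≤ 2) (hc₁ : c₁ ≤ 4 * (n + 2))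
    (hc₂ : c₂ ≤ 2) (hw : F.n + 16 * ((n + 2 + 1) * (2 * F.m + 1)) ≤ 2 ^ w) :
    Reaches P w 0 (liftReduction n s c₁ c₂).length (80 * ((n + 2 + 1) * (2 * F.m + 1)))
      (fun _ => 0) (fun i => F.encode.getD i 0) fun r m' =>
      Regs F.m s (2 * F.m + 2 + F.n) (2 * F.m + 2 + F.n + c₁ * (2 * F.m) + c₂) r ∧
        ∃ tm : ℕ → ℕ, (∀ x, 2 * F.m + 2 + F.n ≤ x → tm x = 0) ∧
        m' = writeList (writeList tm (2 * F.m + 2 + F.n) s (F.untwisted n hn).encode)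
          (2 * F.m + 2 + F.n + c₁ * (2 * F.m) + c₂) s (F.twisted n hn).encode := by
  rw [GraphInput.untwisted, GraphInput.twisted, GraphInput.encode_lift, GraphInput.encode_lift]
  refine (reaches_reduction hc hs hc₁ hc₂ (length_liftItems n _)
    (fun _ => lt_of_mem_liftItems) (length_liftItems n _) (fun _ => lt_of_mem_liftItems) hw
    (L := F.ends) rfl rfl (fun p hp => ⟨rfl, GraphInput.ends_lt hp⟩)
    fun x hx => encode_getD_of_le hx).mono le_rfl ?_
  rintro r m' ⟨hR, hm⟩
  refine ⟨hR, _, fun x hx => ?_, hm⟩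
  rw [tableMem, if_neg (by omega)]
  exact encode_getD_of_le (by omega)

/-- The decision from two homomorphism counts that follow the input graph. -/
def decision : Program :=
  [.const 2 1, .const 3 2, .load 4 2, .op .mul 4 4 3, .op .add 4 4 3, .load 5 4, .op .add 4 4 2,
    .load 6 4, .op .xor 5 5 6, .op .sub 0 2 5]

theorem ends_decision {w h h' : ℕ} (hw : 2 * F.m + 3 < 2 ^ w) (hh : h < 2 ^ w) (hh' : h' < 2 ^ w) :
    Ends decision w (fun c => c.reg 0 = 1 - (h ^^^ h')) 10 (initial (F.encode ++ [h, h'])) := by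
  have hr : Reaches decision w 0 decision.length 10 (fun _ => 0)
      (fun i => (F.encode ++ [h, h']).getD i 0) fun r _ => r 0 = 1 - (h ^^^ h') := by
    have h1 : (F.encode ++ [h, h']).getD 1 0 = F.m := by
      simp [GraphInput.encode]
    have h2 : (F.encode ++ [h, h']).getD (F.m * 2 + 2) 0 = h := by
      rw [List.getD_append_right _ _ _ _ (by rw [F.length_encode]; omega), F.length_encode,
        show F.m * 2 + 2 - (2 * F.m + 2) = 0 by omega]
      rfl
    have h3 : (F.encode ++ [h, h']).getD (F.m * 2 + 2 + 1) 0 = h' := by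
      rw [List.getD_append_right _ _ _ _ (by rw [F.length_encode]; omega), F.length_encode,
        show F.m * 2 + 2 + 1 - (2 * F.m + 2) = 1 by omega]
      rfl
    have := Reaches.of_wp (P := decision) (w := w) (q := 0) (l := decision) (r := fun _ => 0)
      (m := fun i => (F.encode ++ [h, h']).getD i 0) (Q := fun r _ => r 0 = 1 - (h ^^^ h'))
      (codeAt_self _) (by
        simp only [decision, Wp, BinOp.eval, Function.update_self, ne_eq,
          not_false_eq_true, Function.update_of_ne, Nat.reduceEqDiff, h1, h2, h3, and_true]
        refine ⟨by omega, by omega, by omega, by omega, by omega, hh, by omega, hh',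
          Nat.xor_lt_two_pow hh hh', by omega⟩)
    rw [zero_add] at this
    exact this
  have := Ends.of_reaches (K := 0) (Q' := fun c => c.reg 0 = 1 - (h ^^^ h')) hr
    fun r m hQ => Ends.of_halted (le_refl _) hQ
  exact this.mono (by simp)

end

end WordRAM

/-! ### The linear-time reduction and decision -/

open WordRAM in
theorem exists_reduction {k : ℕ} (hk : 4 ≤ k) :
    ∃ (R D : Algorithm) (C : ℕ), ∀ F : GraphInput, ∃ G G' : GraphInput,
      R.HaltsWithin F.n F.encode (C * (F.n + F.m))
        (fun c => c.Holds (c.reg 0) G.encode ∧ c.Holds (c.reg 1) G'.encode) ∧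
      G.n ≤ C * (F.n + F.m) ∧ G.m ≤ C * (F.n + F.m) ∧
      G'.n ≤ C * (F.n + F.m) ∧ G'.m ≤ C * (F.n + F.m) ∧
      D.HaltsWith F.n
        (F.encode ++ [homCount (cycleGraph k) G.graph, homCount (cycleGraph k) G'.graph])
        (fun c => c.reg 0 = triangleFreeAnswer F.graph) ∧
      D.expectedTime F.n
        (F.encode ++ [homCount (cycleGraph k) G.graph, homCount (cycleGraph k) G'.graph]) ≤
        ((C * (F.n + F.m) : ℕ) : ℝ≥0∞) ∧
      (6 ≤ k → IsDegenerate 2 G.graph ∧ IsDegenerate 2 G'.graph) := by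
  obtain ⟨n, rfl⟩ := Nat.exists_eq_add_of_le' (show 2 ≤ k by omega)
  have hn : 1 ≤ n := by omega
  -- An output has two header words and `4 * (n + 2)` words for each of the `2 * F.m` darts, so with
  -- stride `1` the second one follows the first immediately.
  refine ⟨⟨liftReduction n 1 (4 * (n + 2)) 2, GraphInput.wordConst n⟩,
    ⟨decision, GraphInput.wordConst n + GraphInput.countConst n⟩, 160 * (n + 3),
    fun F => ⟨F.untwisted n hn, F.twisted n hn, ?_, ?_⟩⟩
  · obtain ⟨t, ht, r, m', hr, hR, tm, htm, rfl⟩ := reaches_liftReduction (hn := hn)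
      (codeAt_self (liftReduction n 1 (4 * (n + 2)) 2)) one_le_two le_rfl le_rfl
      (F.reduction_bound n).le
    have hT : t ≤ 160 * (n + 3) * (F.n + F.m) := by
      have := F.pos
      nlinarith
    obtain ⟨d, hd⟩ := Nat.exists_eq_add_of_le hT
    have hrun := (run_trans (t := d) hr).trans (run_of_halted (le_refl _) _)
    rw [← hd] at hrun
    refine ⟨_, hrun, le_refl _, ?_, ?_⟩
    · intro i hi
      have hi' := hi
      rw [GraphInput.untwisted, GraphInput.encode_lift,
        length_roundWords (length_liftItems n _)] at hi'
      simp only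
      rw [hR.out₁, writeList_of_lt _ _ _ _ (by omega)]
      simpa using writeList_apply tm (2 * F.m + 2 + F.n) one_pos (F.untwisted n hn).encode hi
    · intro i hi
      simp only
      rw [hR.out₂]
      simpa using writeList_apply _ _ one_pos (F.twisted n hn).encode hi
  · have hsz : 2 * (n + 2) * (2 * F.m + 1) ≤ 160 * (n + 3) * (F.n + F.m) := by
      have := F.pos
      nlinarith
    have hsz' : 2 * (n + 2) * (2 * F.m) ≤ 160 * (n + 3) * (F.n + F.m) :=
      le_trans (Nat.mul_le_mul_left _ (by omega)) hsz
    have hw1 := (F.reduction_bound n).trans_le (two_pow_le_of_le (l := Nat.log 2 F.n + 1)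
      (Nat.le_add_right (GraphInput.wordConst n) (GraphInput.countConst n)))
    have hw2 := two_pow_le_of_le (l := Nat.log 2 F.n + 1)
      (Nat.le_add_left (GraphInput.countConst n) (GraphInput.wordConst n))
    have hE := ends_decision (F := F)
      (h := homCount (cycleGraph (n + 2)) (F.untwisted n hn).graph)
      (h' := homCount (cycleGraph (n + 2)) (F.twisted n hn).graph)
      (w := (GraphInput.wordConst n + GraphInput.countConst n) * (Nat.log 2 F.n + 1))
      (lt_of_le_of_lt (by nlinarith [F.pos]) hw1)
      ((F.count_bound (F.untwisted n hn) n rfl).trans_le hw2)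
      ((F.count_bound (F.twisted n hn) n rfl).trans_le hw2)
    rw [GraphInput.one_sub_xor_eq (by omega)] at hE
    refine ⟨hsz, GraphInput.lift_m.trans_le hsz', hsz, GraphInput.lift_m.trans_le hsz',
      hE.haltsWith (by simp), hE.time.trans ?_,
      fun h6 => ⟨GraphInput.isDegenerate_lift (by omega), GraphInput.isDegenerate_lift (by omega)⟩⟩
    have : 10 ≤ 160 * (n + 3) * (F.n + F.m) := by nlinarith [F.pos]
    exact_mod_cast this

namespace WordRAM

/-! ### Deciding triangle-freeness with an algorithm for homomorphism counts -/

/-- The layout of the simulation on the `i`-th of the two interleaved outputs. -/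
def simLayout (i : Fin 2) : Layout where
  reg x := 16 + 2 * x + i
  inj x y h := by simp only at h; omega
  tmp := 10
  two := 3
  base := i
  tmp_ne_two := by decide
  tmp_ne_base := by omega
  tmp_ne _ := by omega
  two_ne _ := by omega
  base_ne _ := by omega

/-- The comparison of the two results. -/
def compareCode : Program := [.op .xor 10 16 17, .op .sub 0 2 10]

/-- The reduction to the part before the second simulation. -/
def firstPart (n : ℕ) (A : Program) : Program :=
  liftReduction n 2 0 1 ++ (simLayout 0).relocate (liftReduction n 2 0 1).length A

/-- Construct the two graphs, run `A` on both of them, and compare the results. -/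
def triangleProgram (n : ℕ) (A : Program) : Program :=
  (firstPart n A ++ (simLayout 1).relocate (firstPart n A).length A) ++ compareCode

/-- Nothing has to be copied or cleared before a simulation: the cells and registers reserved for it
are already in the initial state. -/
theorem embed_initial {Λ : Layout} {off len b : ℕ} {g h : ℕ → ℕ} {x : List ℕ}
    (hg : ∀ r, g (Λ.reg r) = 0) (hh : ∀ i, h (b + 2 * i) = x.getD i 0) :
    Λ.embed off len b g h (initial x) = ⟨off, g, h⟩ := by
  have h1 : Function.extend Λ.reg (fun _ => 0) g = g := by
    funext y
    by_cases hy : ∃ r, Λ.reg r = y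
    · obtain ⟨r, rfl⟩ := hy
      rw [Λ.inj.extend_apply, hg]
    · rw [Function.extend_apply' _ _ _ hy]
  have h2 : Function.extend (fun i => b + 2 * i) (fun i => x.getD i 0) h = h := by
    have hi : Function.Injective fun i : ℕ => b + 2 * i := fun x y hxy => by
      simp only at hxy; omega
    funext y
    by_cases hy : ∃ i, (fun i => b + 2 * i) i = y
    · obtain ⟨i, rfl⟩ := hy
      exact (hi.extend_apply _ _ _).trans (hh i).symm
    · rw [Function.extend_apply' _ _ _ hy]
  simp only [Layout.embed, initial, Layout.target, h1, h2]
  simp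

/-- The results of the two simulations are compared. -/
theorem ends_compare {P : Program} {w q h h' : ℕ} {r m : ℕ → ℕ} (hc : CodeAt P q compareCode)
    (hP : P.length ≤ q + 2) (h16 : r 16 = h) (h17 : r 17 = h') (h2 : r 2 = 1)
    (hh : h < 2 ^ w) (hh' : h' < 2 ^ w) (hw : 1 < 2 ^ w) :
    Ends P w (fun c => c.reg 0 = 1 - (h ^^^ h')) 2 ⟨q, r, m⟩ := by
  have := Ends.of_reaches (K := 0) (Q' := fun c => c.reg 0 = 1 - (h ^^^ h'))
    (Reaches.of_wp (w := w) (r := r) (m := m) (Q := fun r _ => r 0 = 1 - (h ^^^ h')) hc (by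
      simp only [compareCode, Wp, BinOp.eval, Function.update_self, ne_eq,
        not_false_eq_true, Function.update_of_ne, Nat.reduceEqDiff, h16, h17, h2, and_true]
      exact ⟨Nat.xor_lt_two_pow hh hh', by omega⟩))
    fun r m hQ => Ends.of_halted hP hQ
  exact this.mono (by simp [compareCode])

/-- The first run uses the cells `b + 2 * x` and even registers from `16` on, the second `b + 1 + 2
* x` and odd ones. So the first spoils neither the input of the second nor the constants, and its
result survives in register `16`. -/
theorem ends_triangleProgram {F : GraphInput} {n : ℕ} {hn : 1 ≤ n} {A : Program}
    {w v h h' : ℕ} (hv : 2 ^ v * 2 + (2 * F.m + F.n + 3) ≤ 2 ^ w)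
    (hw : F.n + 16 * ((n + 2 + 1) * (2 * F.m + 1)) ≤ 2 ^ w)
    (hh : h < 2 ^ w) (hh' : h' < 2 ^ w)
    (hA : HaltsWith A v (initial (F.untwisted n hn).encode) fun c => c.reg 0 = h)
    (hA' : HaltsWith A v (initial (F.twisted n hn).encode) fun c => c.reg 0 = h') :
    Ends (triangleProgram n A) w (fun c => c.reg 0 = 1 - (h ^^^ h'))
      ((80 * ((n + 2 + 1) * (2 * F.m + 1)) : ℕ) +
        (3 * expectedTime A v (initial (F.untwisted n hn).encode) +
          (3 * expectedTime A v (initial (F.twisted n hn).encode) + 2))) (initial F.encode) := by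
  have hc := codeAt_self (triangleProgram n A)
  have hlen₁ : (firstPart n A).length = (liftReduction n 2 0 1).length + 3 * A.length := by
    rw [firstPart, List.length_append, Layout.length_relocate]
  have hlen : (triangleProgram n A).length = (firstPart n A).length + 3 * A.length + 2 := by
    rw [triangleProgram, List.length_append, List.length_append, Layout.length_relocate]
    rfl
  have hc₁ := hc.left.left.left
  have hc₂ := hc.left.left.right
  have hc₃ := hc.left.right
  have hc₄ := hc.right
  rw [zero_add] at hc₂ hc₃ hc₄
  rw [List.length_append, Layout.length_relocate] at hc₄
  refine Ends.of_reaches (reaches_liftReduction (F := F) (hn := hn) hc₁ le_rfl (by omega)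
    (by omega) hw) ?_
  rintro r m ⟨hR, tm, htm, rfl⟩
  simp only [zero_mul, add_zero] at hR ⊢
  set b := 2 * F.m + 2 + F.n with hb
  set W := (F.untwisted n hn).encode
  set W' := (F.twisted n hn).encode
  set mem := writeList (writeList tm b 2 W) (b + 1) 2 W' with hmem
  have hread : ∀ x, mem (b + 2 * x) = W.getD x 0 := fun x => by
    rw [hmem, writeList_of_ne _ _ _ _ fun i _ => by omega]
    exact writeList_eq_getD two_pos _ (htm _ (by omega))
  have hread' : ∀ x, mem (b + 1 + 2 * x) = W'.getD x 0 := fun x => by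
    refine writeList_eq_getD two_pos _ ?_
    rw [writeList_of_ne _ _ _ _ fun i _ => by omega]
    exact htm _ (by omega)
  have hi : ¬ ∃ r, (simLayout 0).reg r = 17 := fun ⟨r, h⟩ => by
    simp only [simLayout] at h; omega
  have hsound : ∀ {x : List ℕ} {h : ℕ}, HaltsWith A v (initial x) (fun c => c.reg 0 = h) →
      Sound A v (fun c => c.reg 0 = h) (initial x) := fun h => ⟨h, fun _ => Nat.two_pow_pos v⟩
  rw [← embed_initial (Λ := simLayout 0) (len := A.length) (b := b) (x := W)
    (fun x => hR.high _ (by simp only [simLayout]; omega)) hread]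
  refine Layout.ends_embed (simLayout 0) hc₂ (by omega) (by omega) hR.two hR.out₁ (hsound hA) ?_
  intro a₁ g₁ ha₁ hg₁
  rw [← hlen₁]
  have hlow : ∀ x, x < 16 → x ≠ 10 → Function.extend (simLayout 0).reg a₁.reg g₁ x = r x :=
    fun x hx hx' => by
      rw [Function.extend_apply' _ _ _ fun ⟨y, hy⟩ => by simp only [simLayout] at hy; omega]
      exact hg₁ x hx'
  rw [← embed_initial (Λ := simLayout 1) (len := A.length) (b := b + 1) (x := W')
    (fun x => by
      rw [Function.extend_apply' _ _ _ fun ⟨y, hy⟩ => by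
        simp only [simLayout, Fin.val_zero, Fin.val_one] at hy; omega]
      exact (hg₁ _ (by simp only [simLayout]; omega)).trans
        (hR.high _ (by simp only [simLayout]; omega)))
    (fun x => by
      rw [Function.extend_apply' _ _ _ fun ⟨y, hy⟩ => by omega]
      exact hread' x)]
  refine Layout.ends_embed (simLayout 1) hc₃ (by omega) (by omega)
    ((hlow 3 (by omega) (by omega)).trans hR.two)
    ((hlow 1 (by omega) (by omega)).trans hR.out₂) (hsound hA') ?_
  intro a₂ g₂ ha₂ hg₂
  refine ends_compare hc₄ hlen.le ?_ ?_ ?_ hh hh' (by omega)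
  · rw [Function.extend_apply' _ _ _ fun ⟨y, hy⟩ => by
      simp only [simLayout, Fin.val_one] at hy; omega]
    rw [hg₂ _ (by decide)]
    exact ((simLayout 0).inj.extend_apply a₁.reg g₁ 0).trans ha₁
  · exact ((simLayout 1).inj.extend_apply a₂.reg g₂ 0).trans ha₂
  · rw [Function.extend_apply' _ _ _ fun ⟨y, hy⟩ => by simp only [simLayout] at hy; omega]
    rw [hg₂ _ (by decide), hlow 2 (by omega) (by omega)]
    exact hR.one

end WordRAM

open WordRAM

theorem log_add_one_le {x c l : ℕ} (h : x < 2 ^ (c * l)) : Nat.log 2 x + 1 ≤ c * l + 1 := by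
  rcases Nat.eq_zero_or_pos x with rfl | hx
  · simp
  · have := (Nat.log_lt_iff_lt_pow one_lt_two hx.ne').2 h
    omega

/-- If counting homomorphisms from a cycle of length at least six is easy, then triangle-freeness
can be decided in expected linear time in the number of edges. -/
theorem exists_triangle_algorithm {n : ℕ} (hn : 4 ≤ n)
    (h : HomCountEasy (cycleGraph (n + 2))) : ∃ (B : Algorithm) (K : ℕ),
      B.DecidesTriangleFree ∧
      ∀ F : GraphInput, B.expectedTime F.n F.encode ≤ (K * (F.m + 1) : ℕ) := by
  obtain ⟨f, hf⟩ := h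
  obtain ⟨A, hA⟩ := hf 2
  have hn1 : 1 ≤ n := by omega
  -- The covers have at most `6 * (n + 2) * F.n ^ 2` vertices, so `κ` bounds the bit length in units
  -- of `l`. In `W` the summands serve the words of `A`, the reduction, some slack, and the
  -- homomorphism counts.
  set κ := 6 * (n + 2) + 2
  set W := A.const * (κ + 1) + GraphInput.wordConst n + 3 + GraphInput.countConst n
  set B : Algorithm := ⟨triangleProgram n A.prog, W⟩
  -- Reduction, two threefold simulations at cost `f 2` per vertex of a cover, and comparison, using
  -- `2 * m + 1 ≤ 2 * (m + 1)`.
  set K := 160 * (n + 3) + 24 * (f 2 * (n + 2)) + 2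
  suffices hB : ∀ F : GraphInput, Ends B.prog (B.wordSize F.n)
      (fun c => c.reg 0 = triangleFreeAnswer F.graph) (K * (F.m + 1) : ℕ) (initial F.encode) from
    ⟨B, K, fun F => (hB F).haltsWith (ENNReal.natCast_ne_top _), fun F => (hB F).time⟩
  intro F
  obtain ⟨hG, hGt⟩ := hA (F.untwisted n hn1) (GraphInput.isDegenerate_lift hn)
  obtain ⟨hG', hGt'⟩ := hA (F.twisted n hn1) (GraphInput.isDegenerate_lift hn)
  set l := Nat.log 2 F.n + 1 with hl
  have hv : A.wordSize (2 * (n + 2) * (2 * F.m + 1)) ≤ A.const * (κ + 1) * l := by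
    have h1 : 2 * (n + 2) * (2 * F.m + 1) < 2 ^ (κ * l) := lt_two_pow_log (F.lift_n_le n)
    rw [Algorithm.wordSize, mul_assoc A.const]
    refine Nat.mul_le_mul_left _ ((log_add_one_le h1).trans ?_)
    have : (κ + 1) * l = κ * l + l := Nat.succ_mul κ l
    omega
  have hw := F.reduction_bound n
  have hB : B.wordSize F.n = W * l := rfl
  have hww : 2 ^ (GraphInput.wordConst n * l) ≤ 2 ^ (B.wordSize F.n) :=
    two_pow_le_of_le (show _ ≤ W by simp only [W]; omega)
  have hwc : 2 ^ (GraphInput.countConst n * l) ≤ 2 ^ (B.wordSize F.n) :=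
    two_pow_le_of_le (show _ ≤ W by simp only [W]; omega)
  have hvw : 2 ^ (A.wordSize (2 * (n + 2) * (2 * F.m + 1))) * 2 + (2 * F.m + F.n + 3)
      ≤ 2 ^ (B.wordSize F.n) := by
    have e1 : 2 * F.m + F.n + 3 ≤ 2 ^ (GraphInput.wordConst n * l) :=
      le_trans (by nlinarith [F.pos]) hw.le
    have e2 : 2 ^ (A.wordSize (2 * (n + 2) * (2 * F.m + 1))) * 2
        ≤ 2 ^ (A.const * (κ + 1) * l + 1) := by
      rw [← pow_succ]
      exact Nat.pow_le_pow_right two_pos (by omega)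
    refine (add_le_add e2 e1).trans (two_pow_add_le.trans (Nat.pow_le_pow_right two_pos ?_))
    rw [hB]
    simp only [W, add_mul]
    omega
  have main := ends_triangleProgram (F := F) (hn := hn1) hvw (hw.le.trans hww)
    ((F.count_bound (F.untwisted n hn1) n rfl).trans_le hwc)
    ((F.count_bound (F.twisted n hn1) n rfl).trans_le hwc) hG hG'
  rw [GraphInput.one_sub_xor_eq (by omega)] at main
  refine main.mono ?_
  have e3 : ((80 * ((n + 2 + 1) * (2 * F.m + 1)) : ℕ) : ℝ≥0∞) +
      (3 * ((f 2 : ℝ≥0∞) * (2 * (n + 2) * (2 * F.m + 1) : ℕ)) +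
        (3 * ((f 2 : ℝ≥0∞) * (2 * (n + 2) * (2 * F.m + 1) : ℕ)) + 2)) ≤ (K * (F.m + 1) : ℕ) := by
    have : 80 * ((n + 2 + 1) * (2 * F.m + 1)) + (3 * (f 2 * (2 * (n + 2) * (2 * F.m + 1))) +
        (3 * (f 2 * (2 * (n + 2) * (2 * F.m + 1))) + 2)) ≤ K * (F.m + 1) := by
      simp only [K]
      ring_nf
      omega
    exact_mod_cast this
  refine le_trans ?_ e3
  gcongr
  · exact hGt
  · exact hGt'

/-! ### Hardness under the Triangle Detection Conjecture -/

theorem homCountHard_cycleGraph (hT : TriangleDetectionConjecture) {k : ℕ} (hk : 6 ≤ k) :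
    HomCountHard (cycleGraph k) := by
  obtain ⟨n, rfl⟩ := Nat.exists_eq_add_of_le' (show 2 ≤ k by omega)
  intro h
  obtain ⟨B, K, hB, hK⟩ := exists_triangle_algorithm (by omega) h
  obtain ⟨γ, hγ, hT⟩ := hT
  obtain ⟨a, ha, hf⟩ := hT B hB
  have hev : ∀ᶠ m : ℕ in Filter.atTop, (K : ℝ) * (m + 1) < a * (m : ℝ) ^ (1 + γ) := by
    have h1 : Filter.Tendsto (fun m : ℕ => (m : ℝ) ^ γ) Filter.atTop Filter.atTop :=
      (tendsto_rpow_atTop hγ).comp tendsto_natCast_atTop_atTop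
    -- The factor `2` absorbs `m + 1 ≤ 2 * m`.
    filter_upwards [h1.eventually_gt_atTop (2 * K / a), Filter.eventually_ge_atTop 1] with m hm h1m
    have h1m' : (1 : ℝ) ≤ m := by exact_mod_cast h1m
    rw [div_lt_iff₀ ha] at hm
    rw [Real.rpow_add (by linarith), Real.rpow_one]
    have : (0 : ℝ) ≤ K := Nat.cast_nonneg K
    nlinarith
  obtain ⟨m, ⟨F, rfl, hF⟩, hm⟩ := (hf.and_eventually hev).exists
  have h2 := hF.trans (hK F)
  rw [← ENNReal.ofReal_natCast, ENNReal.ofReal_le_ofReal_iff (Nat.cast_nonneg _)] at h2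
  push_cast at h2
  linarith

theorem lemma1p7 :
    (TriangleDetectionConjecture →
      ∀ k : ℕ, 6 ≤ k → HomCountHard (SimpleGraph.cycleGraph k)) ∧
    ∀ k : ℕ, 4 ≤ k → ∃ (R D : Algorithm) (C : ℕ), ∀ F : GraphInput, ∃ G G' : GraphInput,
      -- `R` constructs `G` and `G'` from `F` in linear time
      R.HaltsWithin F.n F.encode (C * (F.n + F.m))
        (fun c => c.Holds (c.reg 0) G.encode ∧ c.Holds (c.reg 1) G'.encode) ∧
      -- `G` and `G'` have linear size
      G.n ≤ C * (F.n + F.m) ∧ G.m ≤ C * (F.n + F.m) ∧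
      G'.n ≤ C * (F.n + F.m) ∧ G'.m ≤ C * (F.n + F.m) ∧
      -- `D`, given `F` and the two homomorphism counts, decides in expected linear time
      -- whether `F` is triangle-free
      D.HaltsWith F.n
        (F.encode ++ [homCount (SimpleGraph.cycleGraph k) G.graph,
          homCount (SimpleGraph.cycleGraph k) G'.graph])
        (fun c => c.reg 0 = triangleFreeAnswer F.graph) ∧
      D.expectedTime F.n
        (F.encode ++ [homCount (SimpleGraph.cycleGraph k) G.graph,
          homCount (SimpleGraph.cycleGraph k) G'.graph]) ≤
        ((C * (F.n + F.m) : ℕ) : ℝ≥0∞) ∧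
      (6 ≤ k → IsDegenerate 2 G.graph ∧ IsDegenerate 2 G'.graph) := by
  exact ⟨fun hT k hk => homCountHard_cycleGraph hT hk, fun k hk => exists_reduction hk⟩
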